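/- Let $L$ be a complex Lie algebra isomorphic to $o(5,\mathbb C)$ or to $sp(4,\mathbb C)$. All gradings below are decompositions $\Gamma: L=\bigoplus_{j\in J}L_j$ of the vector space $L$ into nonzero subspaces such that for all $j,k\in J$ there is $l\in J$ with $[L_j,L_k]\subseteq L_l$. Such a $\Gamma$ is a *group grading* if $J$ can be embedded into an abelian group so that $[L_j,L_k]\neq 0$ implies $jk\in J$ and $[L_j,L_k]\subseteq L_{jk}$; a group grading is a *fine group grading* if it has no proper refinement that is again a group grading. Two gradings $\bigoplus_{j\in J} L_j$ and $\bigoplus_{k\in K} M_k$ are *equivalent* if there are $h\in\operatorname{Aut}L$ and a bijection $\pi:J\to K$ with $h(L_j)=M_{\pi(j)}$ for all $j$. A *MAD-group* is a set $\mathcal G\subseteq\operatorname{Aut}L$ of pairwise commuting diagonalizable automorphisms that contains every diagonalizable automorphism commuting with all elements of $\mathcal G$; subsets $\mathcal G_1,\mathcal G_2$ of $\operatorname{Aut} L$ are *conjugate* if $h\mathcal G_1h^{-1}=\mathcal G_2$ for some $h\in\operatorname{Aut}L$. Then $o(5,\mathbb C)\cong sp(4,\mathbb C)$, and: 1. $L$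 has, up to conjugacy, exactly three MAD-groups, represented by pairwise non-conjugate $\mathcal G_1,\mathcal G_2,\mathcal G_3$. 2. $L$ has, up to equivalence, exactly three fine group gradings, represented by pairwise non-equivalent $\Gamma_1,\Gamma_2,\Gamma_3$. The representatives can be chosen such that, for each $i$, the subspaces of $\Gamma_i$ are exactly the nonzero simultaneous eigenspaces of $\mathcal G_i$, and $\mathcal G_i$ is exactly the set of automorphisms of $L$ that act as a scalar on each subspace of $\Gamma_i$. 3. $\Gamma_1$ is the Cartan grading, i.e. the root space decomposition of $L$ with respect to a Cartan subalgebra; it consists of one $2$-dimensional and eight $1$-dimensional subspaces. Each of $\Gamma_2$ and $\Gamma_3$ consists of ten $1$-dimensional subspaces. -/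

import Mathlib

/-- The complex Lie algebra `o(5, ℂ)` of skew-symmetric complex `5 × 5` matrices. -/
abbrev O5 : Type := LieAlgebra.Orthogonal.so (Fin 5) ℂ

/-- The complex Lie algebra `sp(4, ℂ)` of complex `4 × 4` matrices that are skew-adjoint for the
standard nondegenerate skew-symmetric form. -/
abbrev Sp4 : Type := LieAlgebra.Symplectic.sp (Fin 2) ℂ

section Automorphisms

variable {L : Type*} [LieRing L] [LieAlgebra ℂ L]

/-- An automorphism is diagonalizable if its eigenspaces span `L`. -/
def IsDiagonalizableAut (g : L ≃ₗ⁅ℂ⁆ L) : Prop :=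
  ⨆ μ : ℂ, Module.End.eigenspace (g : L →ₗ[ℂ] L) μ = ⊤

/-- A MAD-group: a maximal set of pairwise commuting diagonalizable automorphisms. -/
structure IsMADGroup (G : Set (L ≃ₗ⁅ℂ⁆ L)) : Prop where
  diagonalizable : ∀ g ∈ G, IsDiagonalizableAut g
  commute : ∀ f ∈ G, ∀ g ∈ G, ∀ x, f (g x) = g (f x)
  maximal : ∀ h : L ≃ₗ⁅ℂ⁆ L, IsDiagonalizableAut h →
    (∀ g ∈ G, ∀ x, h (g x) = g (h x)) → h ∈ G

/-- Two sets of automorphisms are conjugate if `h G₁ h⁻¹ = G₂` for some automorphism `h`. -/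
def AreConjugate (G₁ G₂ : Set (L ≃ₗ⁅ℂ⁆ L)) : Prop :=
  ∃ h : L ≃ₗ⁅ℂ⁆ L, (fun g => (h.symm.trans g).trans h) '' G₁ = G₂

end Automorphisms

/-- A grading of a complex Lie algebra `L`: a decomposition of the vector space `L` into a direct
sum of nonzero subspaces such that the bracket of any two of them lies in a third one. -/
structure LieGrading (L : Type*) [LieRing L] [LieAlgebra ℂ L] where
  Idx : Type
  space : Idx → Submodule ℂ L
  ne_bot : ∀ j, space j ≠ ⊥
  independent : iSupIndep space
  span : ⨆ j, space j = ⊤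
  bracket : ∀ j k, ∃ l, ∀ x ∈ space j, ∀ y ∈ space k, ⁅x, y⁆ ∈ space l

namespace LieGrading

variable {L : Type*} [LieRing L] [LieAlgebra ℂ L]

/-- `Γ` is a group grading: its index set embeds into an abelian group so that
`[L_j, L_k] ≠ 0` implies that `j * k` is again an index and `[L_j, L_k] ⊆ L_{j * k}`. -/
def IsGroupGrading (Γ : LieGrading L) : Prop :=
  ∃ (A : Type) (_ : CommGroup A) (deg : Γ.Idx → A), Function.Injective deg ∧
    ∀ j k, (∃ x ∈ Γ.space j, ∃ y ∈ Γ.space k, ⁅x, y⁆ ≠ 0) →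
      ∃ l, deg l = deg j * deg k ∧ ∀ x ∈ Γ.space j, ∀ y ∈ Γ.space k, ⁅x, y⁆ ∈ Γ.space l

/-- `Γ'` is a refinement of `Γ`: every subspace of `Γ` is the sum of the subspaces of `Γ'` with
index in the corresponding part of a partition of the index set of `Γ'`. -/
def IsRefinement (Γ' Γ : LieGrading L) : Prop :=
  ∃ p : Γ'.Idx → Γ.Idx, ∀ j, Γ.space j = ⨆ i : {i // p i = j}, Γ'.space i

/-- `Γ'` and `Γ` are the same decomposition of `L` (up to naming the indices). -/
def IsSame (Γ' Γ : LieGrading L) : Prop :=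
  ∃ e : Γ'.Idx ≃ Γ.Idx, ∀ i, Γ'.space i = Γ.space (e i)

/-- A fine group grading: a group grading without a proper refinement that is a group grading. -/
def IsFineGroupGrading (Γ : LieGrading L) : Prop :=
  Γ.IsGroupGrading ∧ ∀ Γ' : LieGrading L, Γ'.IsGroupGrading → Γ'.IsRefinement Γ → Γ'.IsSame Γ

/-- Two gradings are equivalent if an automorphism of `L` carries the subspaces of the first onto
those of the second, along a bijection of the index sets. -/
def IsEquivalent (Γ Γ' : LieGrading L) : Prop :=
  ∃ (h : L ≃ₗ⁅ℂ⁆ L) (π : Γ.Idx ≃ Γ'.Idx), ∀ j,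
    (Γ.space j).map (h : L →ₗ[ℂ] L) = Γ'.space (π j)

/-- `Γ = Gr(G)`: the subspaces of `Γ` are the nonzero simultaneous eigenspaces of `G`. -/
def IsGeneratedBy (Γ : LieGrading L) (G : Set (L ≃ₗ⁅ℂ⁆ L)) : Prop :=
  Set.range Γ.space = {W | W ≠ ⊥ ∧ ∃ χ : (L ≃ₗ⁅ℂ⁆ L) → ℂ,
    W = ⨅ g ∈ G, Module.End.eigenspace (g : L →ₗ[ℂ] L) (χ g)}

/-- `Diag(Γ)`: the automorphisms that act on each subspace of `Γ` as a scalar. -/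
def Diag (Γ : LieGrading L) : Set (L ≃ₗ⁅ℂ⁆ L) :=
  {g | ∀ j, ∃ α : ℂ, ∀ x ∈ Γ.space j, g x = α • x}

/-- `Γ` is a Cartan grading: the root space decomposition with respect to a Cartan subalgebra
(which is itself the root space of `0`). -/
def IsCartanGrading (Γ : LieGrading L) : Prop :=
  ∃ (H : LieSubalgebra ℂ L) (_ : H.IsCartanSubalgebra),
    Set.range Γ.space = {W | W ≠ ⊥ ∧ ∃ χ : H → ℂ, W = (LieAlgebra.rootSpace H χ).toSubmodule}

/-- The number of subspaces of dimension `d` in `Γ`. -/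
noncomputable def numOfDim (Γ : LieGrading L) (d : ℕ) : ℕ :=
  Nat.card {j : Γ.Idx // Module.finrank ℂ (Γ.space j) = d}

end LieGrading

/-! Everything is transported to matrices: $L$ is identified with $o(5)$, directly or through the
spin representation (`spinEquiv`), and $o(5)$ is viewed as the space of bivectors $u\wedge v$ on
$V=\mathbb C^5$.

The automorphisms are known: each is conjugation by an orthogonal matrix $g$ (`exists_eq_conjAut`).
The proof uses no structure theory. A standard generator $E$ satisfies
$(\operatorname{ad}E)^3=-\operatorname{ad}E$. Automorphisms preserve this identity, and it
determines the shape of the matrix so well that the images of the generators can be matched with the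
generators themselves by an intertwiner on $V$. Since the dimension 5 is odd, commuting conjugations
come from commuting matrices (`conjAut_commute_iff`). Since $V$ is irreducible, $g$ is
diagonalizable as soon as conjugation by it is.

A commuting family of diagonalizable automorphisms therefore has a basis of common eigenvectors in
$V$. Two non-orthogonal common eigenvectors have mutually inverse eigenvalues, so a Gram–Schmidt
process can stay among eigenvectors. It yields $p$ orthonormal vectors and $q$ hyperbolic pairs with
$p+2q=5$ (`exists_isHyperbolicFamily`). The values $q=2,1,0$ are the three types. For each type all
such adapted bases form one orbit of the orthogonal group, and the full diagonal group of an adapted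
basis is a MAD-group. The dimension $q$ of its fixed space tells the types apart.

Gradings are linked to these groups by duality. Characters of the grading group act as diagonal
automorphisms and separate the degrees (`isSeparatedBy_diag`), so a fine group grading is determined
by its diagonal group. Applying the classification of commuting families to that group identifies
the grading with the weight grading of an adapted basis. -/

section

/-! ### Bivectors and the natural representation of $o(5)$. -/

open Matrix

attribute [local instance] LieRing.ofAssociativeRing

/-- The endomorphism `z ↦ (v ⬝ z) u - (u ⬝ z) v`, as a matrix. -/
def skewMat (u v : Fin 5 → ℂ) : Matrix (Fin 5) (Fin 5) ℂ := vecMulVec u v - vecMulVec v u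

theorem skewMat_transpose (u v : Fin 5 → ℂ) : (skewMat u v)ᵀ = -skewMat u v := by
  simp [skewMat, transpose_vecMulVec]

theorem skewMat_swap (u v : Fin 5 → ℂ) : skewMat v u = -skewMat u v := by
  simp [skewMat]

theorem skewMat_mulVec (u v z : Fin 5 → ℂ) :
    skewMat u v *ᵥ z = (v ⬝ᵥ z) • u - (u ⬝ᵥ z) • v := by
  simp [skewMat, sub_mulVec, vecMulVec_mulVec]

theorem mul_skewMat_mul_transpose (g : Matrix (Fin 5) (Fin 5) ℂ) (u v : Fin 5 → ℂ) :
    g * skewMat u v * gᵀ = skewMat (g *ᵥ u) (g *ᵥ v) := by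
  simp [skewMat, mul_sub, sub_mul, mul_vecMulVec, vecMulVec_mul, vecMul_transpose]

/-- The derivation rule for the action of skew-symmetric matrices on bivectors. -/
theorem lie_skewMat {Y : Matrix (Fin 5) (Fin 5) ℂ} (hY : Yᵀ = -Y) (x y : Fin 5 → ℂ) :
    Y * skewMat x y - skewMat x y * Y = skewMat (Y *ᵥ x) y + skewMat x (Y *ᵥ y) := by
  have h (z : Fin 5 → ℂ) : z ᵥ* Y = -(Y *ᵥ z) := by
    rw [← neg_mulVec, ← hY, mulVec_transpose]
  simp only [skewMat, mul_sub, sub_mul, mul_vecMulVec, vecMulVec_mul, h]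
  simp only [vecMulVec_neg]
  abel

theorem skewMat_single_apply (i j k l : Fin 5) :
    skewMat (Pi.single i 1) (Pi.single j 1) k l =
      (if k = i ∧ l = j then 1 else 0) - (if k = j ∧ l = i then 1 else 0) := by
  simp only [skewMat, Matrix.sub_apply, vecMulVec_apply, Pi.single_apply, ite_and, ite_mul, one_mul,
    zero_mul]

/-- The factor $1/2$ appears because each unordered pair of indices occurs twice in the sum. -/
theorem eq_sum_skewMat {Z : Matrix (Fin 5) (Fin 5) ℂ} (hZ : Zᵀ = -Z) :
    Z = ∑ i, ∑ j, (Z i j / 2) • skewMat (Pi.single i 1) (Pi.single j 1) := by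
  ext k l
  have h : Z l k = -Z k l := congrFun (congrFun hZ k) l
  simp only [Matrix.sum_apply, Matrix.smul_apply, skewMat_single_apply, smul_eq_mul, mul_sub,
    Finset.sum_sub_distrib, ite_and, mul_ite, mul_one, mul_zero, Finset.sum_ite_eq,
    Finset.mem_univ, if_true, Finset.sum_ite_irrel, Finset.sum_const_zero]
  rw [h]; ring

theorem skewMat_single_mulVec (i j : Fin 5) (v : Fin 5 → ℂ) :
    skewMat (Pi.single i 1) (Pi.single j 1) *ᵥ v = v j • Pi.single i 1 - v i • Pi.single j 1 := by
  simp [skewMat_mulVec]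

/-- The natural representation of `o(5)` is irreducible. -/
theorem eq_top_of_skew_stable (U : Submodule ℂ (Fin 5 → ℂ))
    (h : ∀ Z : Matrix (Fin 5) (Fin 5) ℂ, Zᵀ = -Z → ∀ v ∈ U, Z *ᵥ v ∈ U)
    (hU : U ≠ ⊥) : U = ⊤ := by
  obtain ⟨u, hu, hu0⟩ := U.ne_bot_iff.mp hU
  obtain ⟨j, hj⟩ := Function.ne_iff.mp hu0
  have hE (a b : Fin 5) (v) (hv : v ∈ U) : v b • Pi.single a 1 - v a • Pi.single b 1 ∈ U := by
    rw [← skewMat_single_mulVec]; exact h _ (skewMat_transpose _ _) v hv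
  have step (k i : Fin 5) (hki : k ≠ i) (hv : Pi.single i (1 : ℂ) ∈ U) :
      Pi.single k (1 : ℂ) ∈ U := by
    simpa [hki] using hE k i _ hv
  obtain ⟨k, i, hkj, hij, hki⟩ : ∃ k i : Fin 5, k ≠ j ∧ i ≠ j ∧ k ≠ i := by
    clear hj; decide +revert
  -- Two generators in succession turn $u$ into $u_j e_k$, whose coefficient is nonzero.
  have hk : Pi.single k (1 : ℂ) ∈ U := by
    have := hE k i _ (hE i j u hu)
    simp only [Pi.sub_apply, Pi.smul_apply, Pi.single_eq_same, Pi.single_eq_of_ne hij,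
      Pi.single_eq_of_ne hkj, Pi.single_eq_of_ne hki, smul_eq_mul, mul_one, mul_zero, sub_zero,
      zero_smul] at this
    exact (U.smul_mem_iff hj).mp this
  have hall (l : Fin 5) : Pi.single l (1 : ℂ) ∈ U := by
    by_cases hl : l = k
    · rwa [hl]
    · exact step l k hl hk
  rw [eq_top_iff]
  rintro v -
  rw [pi_eq_sum_univ' v]
  exact U.sum_mem fun l _ => U.smul_mem _ (by convert hall l using 1)

/-- Only scalars commute with all skew-symmetric matrices. -/
theorem exists_eq_smul_one_of_commute {N : Matrix (Fin 5) (Fin 5) ℂ}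
    (h : ∀ Z : Matrix (Fin 5) (Fin 5) ℂ, Zᵀ = -Z → N * Z = Z * N) : ∃ c : ℂ, N = c • 1 := by
  -- Evaluating $NE_{ij}=E_{ij}N$ at $e_j$ gives $Ne_i=N_{jj}e_i-N_{ij}e_j$. Different choices of
  -- $j$ then force the off-diagonal entries to vanish and the diagonal ones to agree.
  have key (i j : Fin 5) (hij : i ≠ j) (k : Fin 5) :
      N k i = N j j * Pi.single (M := fun _ => ℂ) i 1 k - N i j * Pi.single (M := fun _ => ℂ) j 1 k := by
    have h1 := congrArg (· *ᵥ Pi.single j 1) (h _ (skewMat_transpose (Pi.single i 1) (Pi.single j 1)))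
    simp only [← mulVec_mulVec, skewMat_single_mulVec] at h1
    have h2 := congrFun h1 k
    simpa [hij, Pi.single_apply, Matrix.mulVec_single_one] using h2
  refine ⟨N 0 0, ?_⟩
  ext k i
  by_cases hki : k = i
  · subst hki
    by_cases h0 : k = 0
    · subst h0; simp
    · simpa [h0] using key k 0 h0 k
  · obtain ⟨j, hji, hjk⟩ : ∃ j : Fin 5, i ≠ j ∧ k ≠ j := by
      clear key h hki; decide +revert
    simpa [hki, hjk] using key i j hji k

section
variable {L : Type*} [LieRing L] [LieAlgebra ℂ L] (e : L ≃ₗ⁅ℂ⁆ O5)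

/-- The matrix of an element of `L`. -/
def toMat : L →ₗ[ℂ] Matrix (Fin 5) (Fin 5) ℂ :=
  (LieAlgebra.Orthogonal.so (Fin 5) ℂ).toSubmodule.subtype ∘ₗ (e : L →ₗ[ℂ] O5)

theorem toMat_transpose (x : L) : (toMat e x)ᵀ = -toMat e x :=
  (LieAlgebra.Orthogonal.mem_so _ _ _).mp (e x).2

theorem toMat_injective : Function.Injective (toMat e) :=
  Subtype.val_injective.comp e.injective

theorem toMat_lie (x y : L) : toMat e ⁅x, y⁆ = toMat e x * toMat e y - toMat e y * toMat e x := by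
  change ((e ⁅x, y⁆ : O5) : Matrix (Fin 5) (Fin 5) ℂ) = _
  rw [LieEquiv.map_lie]
  rfl

/-- The element of `L` with a given skew-symmetric matrix. -/
def ofMat (Z : Matrix (Fin 5) (Fin 5) ℂ) (hZ : Zᵀ = -Z) : L :=
  e.symm ⟨Z, (LieAlgebra.Orthogonal.mem_so _ _ _).mpr hZ⟩

@[simp]
theorem toMat_ofMat (Z : Matrix (Fin 5) (Fin 5) ℂ) (hZ : Zᵀ = -Z) :
    toMat e (ofMat e Z hZ) = Z := by
  simp [toMat, ofMat]

/-- The bivector `u ∧ v`, as an element of `L`. -/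
def wedge : (Fin 5 → ℂ) →ₗ[ℂ] (Fin 5 → ℂ) →ₗ[ℂ] L :=
  LinearMap.mk₂ ℂ (fun u v => ofMat e (skewMat u v) (skewMat_transpose u v))
    (fun u u' v => toMat_injective e (by
      simp [skewMat, add_vecMulVec, vecMulVec_add]; abel))
    (fun c u v => toMat_injective e (by
      simp [skewMat, smul_vecMulVec, vecMulVec_smul, smul_sub]))
    (fun u v v' => toMat_injective e (by
      simp [skewMat, add_vecMulVec, vecMulVec_add]; abel))
    (fun c u v => toMat_injective e (by
      simp [skewMat, smul_vecMulVec, vecMulVec_smul, smul_sub]))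

@[simp]
theorem toMat_wedge (u v : Fin 5 → ℂ) : toMat e (wedge e u v) = skewMat u v := by
  simp [wedge]

theorem wedge_swap (u v : Fin 5 → ℂ) : wedge e v u = -wedge e u v :=
  toMat_injective e (by simp [skewMat_swap u v])

theorem wedge_self (u : Fin 5 → ℂ) : wedge e u u = 0 :=
  toMat_injective e (by simp [skewMat])

theorem lie_wedge (x : L) (u v : Fin 5 → ℂ) :
    ⁅x, wedge e u v⁆ = wedge e (toMat e x *ᵥ u) v + wedge e u (toMat e x *ᵥ v) :=
  toMat_injective e (by
    rw [toMat_lie, map_add]; simp only [toMat_wedge]; exact lie_skewMat (toMat_transpose e x) u v)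

/-- Conjugation by an orthogonal matrix, as an automorphism of `L`. -/
def conjAut (g : Matrix (Fin 5) (Fin 5) ℂ) (hg : gᵀ * g = 1) : L ≃ₗ⁅ℂ⁆ L where
  toFun x := ofMat e (g * toMat e x * gᵀ) (by
    simp [transpose_mul, toMat_transpose, mul_assoc])
  invFun x := ofMat e (gᵀ * toMat e x * g) (by
    simp [transpose_mul, toMat_transpose, mul_assoc])
  map_add' x y := toMat_injective e (by simp [mul_add, add_mul])
  map_smul' c x := toMat_injective e (by simp)
  map_lie' {x y} := toMat_injective e (by
    simp only [toMat_lie, toMat_ofMat]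
    have h (a b : Matrix (Fin 5) (Fin 5) ℂ) : g * a * gᵀ * (g * b * gᵀ) = g * (a * b) * gᵀ := by
      calc _ = g * a * (gᵀ * g) * b * gᵀ := by simp only [mul_assoc]
        _ = _ := by rw [hg]; simp [mul_assoc]
    rw [h, h, ← sub_mul, ← mul_sub])
  left_inv x := toMat_injective e (by
    simp only [toMat_ofMat]
    calc _ = (gᵀ * g) * toMat e x * (gᵀ * g) := by simp only [mul_assoc]
      _ = _ := by rw [hg]; simp)
  right_inv x := toMat_injective e (by
    have hg' : g * gᵀ = 1 := mul_eq_one_comm.mp hg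
    simp only [toMat_ofMat]
    calc _ = (g * gᵀ) * toMat e x * (g * gᵀ) := by simp only [mul_assoc]
      _ = _ := by rw [hg']; simp)

@[simp]
theorem toMat_conjAut (g : Matrix (Fin 5) (Fin 5) ℂ) (hg : gᵀ * g = 1) (x : L) :
    toMat e (conjAut e g hg x) = g * toMat e x * gᵀ :=
  toMat_ofMat e (g * toMat e x * gᵀ) (by simp [transpose_mul, toMat_transpose, mul_assoc])

theorem conjAut_wedge (g : Matrix (Fin 5) (Fin 5) ℂ) (hg : gᵀ * g = 1) (u v : Fin 5 → ℂ) :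
    conjAut e g hg (wedge e u v) = wedge e (g *ᵥ u) (g *ᵥ v) :=
  toMat_injective e (by simp [mul_skewMat_mul_transpose])

end

end

/-! ### Matrices $Y$ with $(\operatorname{ad}Y)^3=-\operatorname{ad}Y$ on $o(5)$. -/

section

open Matrix

theorem trace_eq_zero_of_transpose_eq_neg {A : Matrix (Fin 5) (Fin 5) ℂ} (h : Aᵀ = -A) :
    A.trace = 0 := by
  have := trace_transpose A
  rw [h, trace_neg] at this
  exact self_eq_neg.mp this.symm

/-- This contraction is the main tool of this part: an identity $\sum PZQ=0$ valid for all skew $Z$,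
applied to $Z=e_i\wedge v$ and summed over $i$, becomes an identity among the fixed matrices $P,Q$
alone. -/
theorem sum_skewMat_contract (P Q : Matrix (Fin 5) (Fin 5) ℂ) (v : Fin 5 → ℂ) :
    ∑ i, (P * skewMat (Pi.single i 1) v * Q) *ᵥ Pi.single i 1 =
      (P * Qᵀ - Q.trace • P) *ᵥ v := by
  have h (i : Fin 5) : (P * skewMat (Pi.single i 1) v * Q) *ᵥ Pi.single i 1 =
      P *ᵥ ((Qᵀ *ᵥ v) i • Pi.single i 1 - Q i i • v) := by
    rw [← mulVec_mulVec, ← mulVec_mulVec, skewMat_mulVec]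
    congr 3
    · rw [mulVec_single_one]; simp [mulVec, dotProduct, mul_comm]
    · simp
  have h2 : ∑ i, (Qᵀ *ᵥ v) i • Pi.single i (1 : ℂ) = Qᵀ *ᵥ v := by
    ext m; simp [Finset.sum_apply, Pi.single_apply]
  simp only [h, ← mulVec_sum, Finset.sum_sub_distrib, h2, ← Finset.sum_smul]
  rw [mulVec_sub, mulVec_smul, sub_mulVec, smul_mulVec, mulVec_mulVec]
  rfl

/-- The left side is skew and is built from $u$ and $v$ only, so it must be a multiple of $u\wedge
v$. -/
theorem skew_sandwich {u v : Fin 5 → ℂ} {Z : Matrix (Fin 5) (Fin 5) ℂ} (hZ : Zᵀ = -Z) :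
    skewMat u v * Z * skewMat u v = -(u ⬝ᵥ Z *ᵥ v) • skewMat u v := by
  have hs (x y : Fin 5 → ℂ) : x ᵥ* Z ⬝ᵥ y = x ⬝ᵥ Z *ᵥ y := (dotProduct_mulVec _ _ _).symm
  have hz (x y : Fin 5 → ℂ) : y ⬝ᵥ Z *ᵥ x = -(x ⬝ᵥ Z *ᵥ y) := by
    rw [dotProduct_mulVec, ← mulVec_transpose, hZ, neg_mulVec, neg_dotProduct, dotProduct_comm]
  have h0 (x : Fin 5 → ℂ) : x ⬝ᵥ Z *ᵥ x = 0 := self_eq_neg.mp (hz x x)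
  simp only [skewMat, sub_mul, mul_sub, vecMulVec_mul, vecMul_vecMulVec, hs, h0, hz u v]
  simp only [vecMulVec_smul, neg_smul, zero_smul, smul_sub, vecMulVec_neg, vecMulVec_zero]
  abel

/-- A skew-symmetric matrix of rank two with eigenvalues `± i` and `0`. -/
structure IsRotationGenerator (Y : Matrix (Fin 5) (Fin 5) ℂ) : Prop where
  skew : Yᵀ = -Y
  cube : Y * Y * Y = -Y
  trace_sq : (Y * Y).trace = -2
  sandwich : ∀ Z : Matrix (Fin 5) (Fin 5) ℂ, Zᵀ = -Z → Y * Y * Z * Y = Y * Z * Y * Y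

/-- The hypothesis `H` is $(\operatorname{ad}Y)^3Z+(\operatorname{ad}Y)Z=0$ written out. Contracting
it gives $Y^3=(t+1)Y$ with $t=\operatorname{tr}Y^2$; testing it on $u\wedge v$ with $u\in\ker Y$
gives $t=-2$. Inserting $Y^3=-Y$ back into `H` leaves the sandwich relation. -/
theorem isRotationGenerator_of_ad_cube {Y : Matrix (Fin 5) (Fin 5) ℂ} (hY : Yᵀ = -Y) (h0 : Y ≠ 0)
    (H : ∀ Z : Matrix (Fin 5) (Fin 5) ℂ, Zᵀ = -Z →
      Y * Y * Y * Z - (3 : ℂ) • (Y * Y * Z * Y) + (3 : ℂ) • (Y * Z * (Y * Y)) - Z * (Y * Y * Y)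
        + Y * Z - Z * Y = 0) :
    IsRotationGenerator Y := by
  have ht : Y.trace = 0 := trace_eq_zero_of_transpose_eq_neg hY
  have hY3 : (Y * Y * Y)ᵀ = -(Y * Y * Y) := by simp [transpose_mul, hY, mul_assoc]
  have ht3 : (Y * Y * Y).trace = 0 := trace_eq_zero_of_transpose_eq_neg hY3
  set t := (Y * Y).trace with htdef
  have hcube : Y * Y * Y = (t + 1) • Y := by
    have key : (3 : ℂ) • (Y * Y * Y - (t + 1) • Y) = 0 := by
      refine ext_of_mulVec_single fun k => ?_
      set v : Fin 5 → ℂ := Pi.single k 1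
      have e1 := sum_skewMat_contract (Y * Y * Y) 1 v
      have e2 := sum_skewMat_contract (Y * Y) Y v
      have e3 := sum_skewMat_contract Y (Y * Y) v
      have e4 := sum_skewMat_contract 1 (Y * Y * Y) v
      have e5 := sum_skewMat_contract Y 1 v
      have e6 := sum_skewMat_contract 1 Y v
      have hs : ∑ i : Fin 5, (Y * Y * Y * skewMat (Pi.single i 1) v * 1
          - (3 : ℂ) • (Y * Y * skewMat (Pi.single i 1) v * Y)
          + (3 : ℂ) • (Y * skewMat (Pi.single i 1) v * (Y * Y))
          - 1 * skewMat (Pi.single i 1) v * (Y * Y * Y) + Y * skewMat (Pi.single i 1) v * 1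
          - 1 * skewMat (Pi.single i 1) v * Y) *ᵥ Pi.single i 1 = 0 := by
        refine Finset.sum_eq_zero fun i _ => ?_
        simp only [mul_one, one_mul]
        rw [H _ (skewMat_transpose _ _), zero_mulVec]
      simp only [add_mulVec, sub_mulVec, smul_mulVec, Finset.sum_add_distrib,
        Finset.sum_sub_distrib, ← Finset.smul_sum, e1, e2, e3, e4, e5, e6] at hs
      simp only [← add_mulVec, ← sub_mulVec, ← smul_mulVec] at hs
      rw [zero_mulVec, ← hs]
      congr 1
      simp only [hY, hY3, transpose_one, transpose_mul, ht, ht3, trace_one, ← htdef]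
      simp only [mul_neg, neg_mul, neg_neg, mul_one, one_mul, zero_smul, Fintype.card_fin,
        mul_assoc]
      push_cast
      module
    rw [smul_eq_zero] at key
    exact sub_eq_zero.mp (key.resolve_left (by norm_num))
  -- A skew matrix of odd size is singular, which supplies the kernel vector $u$.
  have hdet : Y.det = 0 := by
    have := det_transpose Y
    rw [hY, det_neg, Fintype.card_fin] at this
    have : -Y.det = Y.det := by simpa [Odd.neg_one_pow (by decide : Odd 5)] using this
    exact self_eq_neg.mp this.symm
  obtain ⟨u, hu0, hu⟩ := exists_mulVec_eq_zero_iff.mpr hdet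
  have huY : u ᵥ* Y = 0 := by
    rw [← mulVec_transpose, hY, neg_mulVec, hu, neg_zero]
  have htr : t = -2 := by
    by_contra hne
    -- For $Z=u\wedge v$ the terms containing $YZY$ vanish and `H` becomes $(t+2)[Y,Z]=0$, where
    -- $[Y,Z]=u\wedge Yv$. If $t\neq-2$, the image of $Y$ lies in the line of $u$, so $Y^2=0$, and
    -- then the cubic relation reads $0=Y$.
    have h1 (v : Fin 5 → ℂ) : skewMat u (Y *ᵥ v) = 0 := by
      have hYZ : Y * skewMat u v = -vecMulVec (Y *ᵥ v) u := by
        simp [skewMat, mul_sub, mul_vecMulVec, hu]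
      have hYZY : Y * skewMat u v * Y = 0 := by
        simp [hYZ, vecMulVec_mul, huY]
      have h2 := H _ (skewMat_transpose u v)
      have h3 : Y * skewMat u v - skewMat u v * Y = skewMat u (Y *ᵥ v) := by
        rw [lie_skewMat hY, hu]; simp [skewMat]
      rw [hcube, mul_assoc Y Y, mul_assoc Y (Y * _), hYZY, ← mul_assoc _ Y Y, hYZY] at h2
      have h4 : (t + 2) • skewMat u (Y *ᵥ v) = 0 := by
        rw [← h3, ← h2]
        simp only [smul_mul_assoc, mul_smul_comm, mul_zero, zero_mul]
        module
      exact (smul_eq_zero.mp h4).resolve_left fun h => hne (by linear_combination h)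
    obtain ⟨k, hk⟩ := Function.ne_iff.mp hu0
    have h5 (v : Fin 5 → ℂ) : Y *ᵥ v = ((Y *ᵥ v) k / u k) • u := by
      ext l
      have := congrFun (congrFun (h1 v) k) l
      simp only [skewMat, Matrix.sub_apply, vecMulVec_apply, Matrix.zero_apply] at this
      rw [Pi.smul_apply, smul_eq_mul, div_mul_eq_mul_div, eq_div_iff hk]
      linear_combination this
    have h6 : Y * Y = 0 := by
      refine ext_of_mulVec_single fun k => ?_
      rw [← mulVec_mulVec, h5 (Pi.single k 1), mulVec_smul, hu, smul_zero, zero_mulVec]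
    rw [htdef, h6] at hcube
    simp at hcube
    exact h0 hcube.symm
  have hc : Y * Y * Y = -Y := by rw [hcube, htr]; module
  refine ⟨hY, hc, htr, fun Z hZ => ?_⟩
  have := H Z hZ
  rw [hc, mul_neg, neg_mul] at this
  have h7 : (3 : ℂ) • (Y * Y * Z * Y - Y * Z * Y * Y) = 0 := by
    rw [mul_assoc _ Y Y, ← neg_eq_zero, ← this]
    module
  exact sub_eq_zero.mp ((smul_eq_zero.mp h7).resolve_left (by norm_num))

/-- Two commuting rotation generators are proportional or have disjoint support. -/
theorem IsRotationGenerator.mul_eq_zero_or {A B : Matrix (Fin 5) (Fin 5) ℂ}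
    (hA : IsRotationGenerator A) (hB : IsRotationGenerator B) (hAB : A * B = B * A) :
    A * B = 0 ∨ ∃ c : ℂ, B = c • A := by
  -- Contracting $A^2Z(AB)=AZ(A^2B)$ gives $-AB-\operatorname{tr}(AB)A^2=AB$. Exchanging $A$ and $B$
  -- gives the same with $B^2$, so a nonzero trace forces $A^2=B^2$.
  have key {A B : Matrix (Fin 5) (Fin 5) ℂ} (hA : IsRotationGenerator A)
      (hB : IsRotationGenerator B) (hAB : A * B = B * A) :
      (-2 : ℂ) • (A * B) = (A * B).trace • (A * A) := by
    have hAAB : A * A * B = B * (A * A) := by rw [mul_assoc, hAB, ← mul_assoc, hAB, mul_assoc]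
    have ht : (A * A * B).trace = 0 := trace_eq_zero_of_transpose_eq_neg (by
      rw [transpose_mul, transpose_mul, hA.skew, hB.skew, hAAB]; simp)
    refine ext_of_mulVec_single fun k => ?_
    have e1 := sum_skewMat_contract (A * A) (A * B) (Pi.single k 1)
    have e2 := sum_skewMat_contract A (A * A * B) (Pi.single k 1)
    have : ∀ i : Fin 5, (A * A * skewMat (Pi.single i 1) (Pi.single k 1) * (A * B)) =
        A * skewMat (Pi.single i 1) (Pi.single k 1) * (A * A * B) := fun i => by
      rw [← mul_assoc, hA.sandwich _ (skewMat_transpose _ _)]; simp only [mul_assoc]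
    simp only [this, e2, ht] at e1
    have h3 : A * A * (A * B) = -(A * B) := by rw [← mul_assoc, hA.cube, neg_mul]
    have h4 : A * (A * A * B)ᵀ = A * B := by
      rw [transpose_mul, transpose_mul, hA.skew, hB.skew]
      simp only [mul_neg, neg_mul, neg_neg]
      rw [← hAAB, ← mul_assoc, ← mul_assoc, hA.cube]; simp
    have h5 : (A * B)ᵀ = A * B := by rw [transpose_mul, hA.skew, hB.skew, neg_mul_neg, hAB]
    rw [h4, h5, h3, zero_smul, sub_zero, sub_mulVec, eq_sub_iff_add_eq, ← eq_sub_iff_add_eq'] at e1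
    rw [e1, ← sub_mulVec]
    congr 1
    module
  have h1 := key hA hB hAB
  have h2 := key hB hA hAB.symm
  rw [← hAB] at h2
  by_cases hs : (A * B).trace = 0
  · left
    rw [hs, zero_smul] at h1
    exact (smul_eq_zero.mp h1).resolve_left (by norm_num)
  · right
    have h3 : A * A = B * B := smul_right_injective _ hs (h1.symm.trans h2)
    have h4 := congrArg (A * ·) h1
    simp only [mul_smul_comm, ← mul_assoc, hA.cube] at h4
    rw [h3, hB.cube] at h4
    refine ⟨-(A * B).trace / 2, ?_⟩
    calc B = (1 / 2 : ℂ) • ((-2 : ℂ) • -B) := by module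
      _ = _ := by rw [h4]; module

end

/-! ### Automorphisms of $o(5)$ are conjugations by orthogonal matrices. -/

section

open Matrix

/-- Matrices satisfying the relations of the standard rotation generators of `o(5)`. -/
structure IsRotationFrame (F : Fin 5 → Fin 5 → Matrix (Fin 5) (Fin 5) ℂ) : Prop where
  swap : ∀ i j, F j i = -F i j
  lie : ∀ i j k l, F i j * F k l - F k l * F i j =
    (if j = k then F i l else 0) - (if i = k then F j l else 0) + (if j = l then F k i else 0)
      - (if i = l then F k j else 0)
  rotation : ∀ i j, i ≠ j → IsRotationGenerator (F i j)
  disjoint : ∀ i j k l, i ≠ j → i ≠ k → i ≠ l → j ≠ k → j ≠ l → k ≠ l → F i j * F k l = 0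
  faithful : ∀ v : Fin 5 → ℂ, (∀ i j, F i j *ᵥ v = 0) → v = 0

section
variable {L : Type*} [LieRing L] [LieAlgebra ℂ L] (e : L ≃ₗ⁅ℂ⁆ O5)

theorem lieEquiv_apply_eq_iff (φ : L ≃ₗ⁅ℂ⁆ L) {x y : L} : φ x = φ y ↔ x = y :=
  ⟨fun h => φ.injective h, congrArg φ⟩

theorem lie_wedge_wedge (u v x y : Fin 5 → ℂ) :
    ⁅wedge e u v, wedge e x y⁆ = (v ⬝ᵥ x) • wedge e u y - (u ⬝ᵥ x) • wedge e v y
      + (v ⬝ᵥ y) • wedge e x u - (u ⬝ᵥ y) • wedge e x v := by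
  rw [lie_wedge, toMat_wedge, skewMat_mulVec, skewMat_mulVec]
  simp only [map_sub, map_smul, LinearMap.sub_apply, LinearMap.smul_apply]
  abel

/-- The bivector rotates one plane, with eigenvalues $\pm i,0,0,0$ on $V$, so its eigenvalues on
bivectors are again only $\pm i$ and $0$. Being an identity of brackets, this is preserved by every
automorphism. -/
theorem lie_lie_lie_wedge {u v : Fin 5 → ℂ} (hu : u ⬝ᵥ u = 1) (hv : v ⬝ᵥ v = 1)
    (huv : u ⬝ᵥ v = 0) (z : L) :
    ⁅wedge e u v, ⁅wedge e u v, ⁅wedge e u v, z⁆⁆⁆ = -⁅wedge e u v, z⁆ := by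
  apply toMat_injective e
  simp only [toMat_lie, map_neg, toMat_wedge]
  have h1 := skew_sandwich (u := u) (v := v) (toMat_transpose e z)
  have h2 := skew_sandwich (u := u) (v := v) (skewMat_transpose u v)
  rw [skewMat_mulVec, hv, huv, zero_smul, sub_zero, one_smul, hu, neg_one_smul] at h2
  generalize skewMat u v = E at *
  generalize toMat e z = Z at *
  have h3 : E * E * Z * E = E * Z * E * E := by
    calc _ = E * (E * Z * E) := by simp only [mul_assoc]
      _ = E * Z * E * E := by rw [h1]; simp
  calc _ = E * E * E * Z - 3 * (E * E * Z * E - E * Z * E * E) - Z * (E * E * E) := by noncomm_ring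
    _ = _ := by rw [h2, h3]; noncomm_ring

theorem dotProduct_single_single (i j : Fin 5) :
    (Pi.single i 1 : Fin 5 → ℂ) ⬝ᵥ Pi.single j 1 = if i = j then 1 else 0 := by
  simp [Pi.single_apply, eq_comm]

theorem wedge_single_ne_zero {i j : Fin 5} (h : i ≠ j) :
    wedge e (Pi.single i 1) (Pi.single j 1) ≠ 0 := fun h0 => by
  have h1 := congrFun (congrFun (congrArg (toMat e) h0) i) j
  rw [toMat_wedge, skewMat_single_apply] at h1
  simp [h] at h1

theorem isRotationGenerator_aut (φ : L ≃ₗ⁅ℂ⁆ L) {i j : Fin 5} (h : i ≠ j) :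
    IsRotationGenerator (toMat e (φ (wedge e (Pi.single i 1) (Pi.single j 1)))) := by
  set w := wedge e (Pi.single i 1) (Pi.single j 1) with hw
  have hw0 : w ≠ 0 := wedge_single_ne_zero e h
  refine isRotationGenerator_of_ad_cube (toMat_transpose e _) ?_ fun Z hZ => ?_
  · rw [Ne, ← map_zero (toMat e), (toMat_injective e).eq_iff, ← map_zero φ, lieEquiv_apply_eq_iff]
    exact hw0
  · obtain ⟨z, rfl⟩ : ∃ z, Z = toMat e (φ z) := ⟨φ.symm (ofMat e Z hZ), by simp⟩
    have h1 := congrArg (fun x => toMat e (φ x)) (lie_lie_lie_wedge e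
      (by simp) (by simp) (by simp [h]) z :
        ⁅w, ⁅w, ⁅w, z⁆⁆⁆ = -⁅w, z⁆)
    simp only [LieEquiv.map_lie, map_neg, toMat_lie] at h1
    generalize toMat e (φ w) = Y at *
    generalize toMat e (φ z) = Z at *
    rw [← sub_eq_zero] at h1
    rw [← h1, show (3 : ℂ) = ((3 : ℕ) : ℂ) by norm_num, Nat.cast_smul_eq_nsmul,
      Nat.cast_smul_eq_nsmul]
    noncomm_ring

/-- Vanishing products are not a statement about brackets. They follow because commuting rotation
generators have product zero or are proportional, and an automorphism cannot make independent
generators proportional. -/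
theorem isRotationFrame_aut (φ : L ≃ₗ⁅ℂ⁆ L) :
    IsRotationFrame fun i j => toMat e (φ (wedge e (Pi.single i 1) (Pi.single j 1))) where
  swap i j := by rw [wedge_swap]; simp
  lie i j k l := by
    rw [← toMat_lie, ← LieEquiv.map_lie, lie_wedge_wedge]
    simp only [dotProduct_single_single]
    split_ifs <;> simp
  rotation i j h := isRotationGenerator_aut e φ h
  disjoint i j k l hij hik hil hjk hjl hkl := by
    refine ((isRotationGenerator_aut e φ hij).mul_eq_zero_or (isRotationGenerator_aut e φ hkl)
      ?_).resolve_right ?_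
    · rw [← sub_eq_zero, ← toMat_lie, ← LieEquiv.map_lie, lie_wedge_wedge]
      simp [hik, hil, hjk, hjl]
    · rintro ⟨c, hc⟩
      rw [← map_smul, (toMat_injective e).eq_iff, ← map_smul, lieEquiv_apply_eq_iff] at hc
      have h1 := congrFun (congrFun (congrArg (toMat e) hc) k) l
      rw [map_smul, toMat_wedge, toMat_wedge, Matrix.smul_apply, skewMat_single_apply,
        skewMat_single_apply] at h1
      simp [hik.symm, hkl, hjk.symm] at h1
  faithful v hv := by
    have h1 (Z : Matrix (Fin 5) (Fin 5) ℂ) (hZ : Zᵀ = -Z) : Z *ᵥ v = 0 := by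
      obtain ⟨z, rfl⟩ : ∃ z, Z = toMat e (φ z) := ⟨φ.symm (ofMat e Z hZ), by simp⟩
      have : z = ∑ i, ∑ j, (toMat e z i j / 2) • wedge e (Pi.single i 1) (Pi.single j 1) :=
        toMat_injective e (by
          simp only [map_sum, map_smul, toMat_wedge]; exact eq_sum_skewMat (toMat_transpose e z))
      rw [this]
      simp only [map_sum, map_smul, sum_mulVec, smul_mulVec, hv, smul_zero, Finset.sum_const_zero]
    ext j
    obtain ⟨i, hij⟩ : ∃ i : Fin 5, i ≠ j := exists_ne j
    have h2 := congrFun (h1 _ (skewMat_transpose (Pi.single i 1) (Pi.single j 1))) i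
    rw [skewMat_single_mulVec] at h2
    simpa [hij] using h2

end

namespace IsRotationFrame

variable {F : Fin 5 → Fin 5 → Matrix (Fin 5) (Fin 5) ℂ}

theorem self (hF : IsRotationFrame F) (i : Fin 5) : F i i = 0 := by
  ext k l
  exact self_eq_neg.mp (congrFun (congrFun (hF.swap i i) k) l)

theorem mul_mulVec (hF : IsRotationFrame F) (i j k l : Fin 5) (v : Fin 5 → ℂ) : F i j *ᵥ F k l *ᵥ v =
    F k l *ᵥ F i j *ᵥ v + ((if j = k then F i l *ᵥ v else 0) - (if i = k then F j l *ᵥ v else 0)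
      + (if j = l then F k i *ᵥ v else 0) - (if i = l then F k j *ᵥ v else 0)) := by
  have h := congrArg (· *ᵥ v) (hF.lie i j k l)
  simp only [sub_mulVec, add_mulVec, ← mulVec_mulVec] at h
  rw [← sub_eq_iff_eq_add', h]
  split_ifs <;> simp

/-- The matrix $P=1+F_{01}^2+F_{23}^2$ is killed from the left by both generators, since $F^3=-F$
and $F_{01}F_{23}=0$. It is nonzero because its trace is $5-2-2=1$. -/
theorem exists_kernel (hF : IsRotationFrame F) :
    ∃ f : Fin 5 → ℂ, f ≠ 0 ∧ F 0 1 *ᵥ f = 0 ∧ F 2 3 *ᵥ f = 0 := by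
  have h1 := hF.rotation 0 1 (by decide)
  have h2 := hF.rotation 2 3 (by decide)
  have h12 := hF.disjoint 0 1 2 3 (by decide) (by decide) (by decide) (by decide) (by decide)
    (by decide)
  have h21 := hF.disjoint 2 3 0 1 (by decide) (by decide) (by decide) (by decide) (by decide)
    (by decide)
  set P := 1 + F 0 1 * F 0 1 + F 2 3 * F 2 3 with hP
  have hP0 : P ≠ 0 := fun h => by
    have := congrArg trace h
    rw [hP, trace_add, trace_add, h1.trace_sq, h2.trace_sq, trace_one, trace_zero] at this
    norm_num at this
  obtain ⟨v, hv⟩ : ∃ v, P *ᵥ v ≠ 0 := by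
    by_contra! hc
    exact hP0 (ext_of_mulVec_single fun i => by rw [hc, zero_mulVec])
  refine ⟨_, hv, ?_, ?_⟩
  · rw [mulVec_mulVec, hP, mul_add, mul_add, ← mul_assoc, ← mul_assoc, h1.cube, h12]; simp
  · rw [mulVec_mulVec, hP, mul_add, mul_add, ← mul_assoc, ← mul_assoc, h2.cube, h21]; simp

/-- A vector on which the generators of the first four coordinates act trivially. -/
theorem exists_fixed (hF : IsRotationFrame F) :
    ∃ f : Fin 5 → ℂ, f ≠ 0 ∧ ∀ i j, i ≠ 4 → j ≠ 4 → F i j *ᵥ f = 0 := by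
  obtain ⟨f, hf0, h01, h23⟩ := hF.exists_kernel
  have h (v : Fin 5 → ℂ) : F 0 1 *ᵥ F 2 3 *ᵥ v = 0 := by
    rw [mulVec_mulVec, hF.disjoint 0 1 2 3 (by decide) (by decide) (by decide) (by decide)
      (by decide) (by decide), zero_mulVec]
  -- Apply $F_{01}F_{23}=0$ to $F_{13}f$: commuting both factors to the right, where they kill $f$,
  -- leaves $F_{02}f$. The next three steps repeat this with other indices.
  have h02 : F 0 2 *ᵥ f = 0 := by
    have := h (F 1 3 *ᵥ f)
    rw [hF.mul_mulVec 2 3 1 3] at this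
    simp [h23, hF.mul_mulVec 0 1 1 2, h01] at this
    exact this
  have h12 : F 1 2 *ᵥ f = 0 := by
    have := h (F 0 3 *ᵥ f)
    rw [hF.mul_mulVec 2 3 0 3] at this
    simp [h23, hF.mul_mulVec 0 1 0 2, h01] at this
    exact this
  have h03 : F 0 3 *ᵥ f = 0 := by
    have := h (F 1 2 *ᵥ f)
    rw [hF.mul_mulVec 2 3 1 2] at this
    simp [h23, mulVec_neg, hF.mul_mulVec 0 1 1 3, h01] at this
    exact this
  have h13 : F 1 3 *ᵥ f = 0 := by
    have := h (F 0 2 *ᵥ f)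
    rw [hF.mul_mulVec 2 3 0 2] at this
    simp [h23, mulVec_neg, hF.mul_mulVec 0 1 0 3, h01] at this
    exact this
  have hs (i j) (h : F i j *ᵥ f = 0) : F j i *ᵥ f = 0 := by
    rw [hF.swap, neg_mulVec, h, neg_zero]
  have hd (i) : F i i *ᵥ f = 0 := by rw [hF.self, zero_mulVec]
  refine ⟨f, hf0, fun i j hi hj => ?_⟩
  have h10 := hs _ _ h01
  have h20 := hs _ _ h02
  have h30 := hs _ _ h03
  have h21 := hs _ _ h12
  have h31 := hs _ _ h13
  have h32 := hs _ _ h23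
  fin_cases i <;> fin_cases j <;>
    first | exact absurd rfl hi | exact absurd rfl hj | exact hd _ | assumption

/-- The vectors `F i 4 f` and `f` form an orthonormal frame. -/
theorem mulVec_mulVec_fixed (hF : IsRotationFrame F) {f : Fin 5 → ℂ}
    (hf : ∀ i j, i ≠ 4 → j ≠ 4 → F i j *ᵥ f = 0) {i j : Fin 5} (hi : i ≠ 4) (hj : j ≠ 4) :
    F i 4 *ᵥ F j 4 *ᵥ f = if i = j then -f else 0 := by
  -- With a spare index $k$, write $F_{i4}=[F_{ik},F_{k4}]$; the factor $F_{ik}$ is annihilated by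
  -- the disjoint generator $F_{j4}$.
  have hoff {i j : Fin 5} (hi : i ≠ 4) (hj : j ≠ 4) (hij : i ≠ j) : F i 4 *ᵥ F j 4 *ᵥ f = 0 := by
    obtain ⟨k, hk, hki, hkj⟩ : ∃ k : Fin 5, k ≠ 4 ∧ k ≠ i ∧ k ≠ j := by
      clear hi hj hij hf; decide +revert
    have h1 := hF.mul_mulVec i k k 4 (F j 4 *ᵥ f)
    have h2 : F i k *ᵥ F j 4 *ᵥ f = 0 := by
      rw [mulVec_mulVec, hF.disjoint i k j 4 hki.symm hij hi hkj hk hj, zero_mulVec]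
    have h3 : F i k *ᵥ F k 4 *ᵥ F j 4 *ᵥ f = 0 := by
      have h4 : F i k * F j 4 = 0 := hF.disjoint i k j 4 hki.symm hij hi hkj hk hj
      rw [hF.mul_mulVec k 4 j 4]
      simp [hkj, hj.symm, hk, hf j k hj hk, ← mul_assoc, h4]
    rw [h3, h2] at h1
    simpa only [mulVec_zero, if_true, if_neg hki.symm, if_neg hk, if_neg hi, sub_zero, add_zero,
      zero_add, eq_comm] using h1
  have heq {i j : Fin 5} (hi : i ≠ 4) (hj : j ≠ 4) (hij : i ≠ j) :
      F i 4 *ᵥ F i 4 *ᵥ f = F j 4 *ᵥ F j 4 *ᵥ f := by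
    have h1 := congrArg (F i j *ᵥ ·) (hoff hi hj hij)
    simp only [mulVec_zero] at h1
    rw [hF.mul_mulVec i j i 4, hF.mul_mulVec i j j 4, hf i j hi hj] at h1
    simp [hij, hij.symm, hi, hj] at h1
    rw [← sub_eq_zero, sub_eq_add_neg]
    simpa [add_comm] using h1
  split_ifs with hij
  · subst hij
    rw [← add_eq_zero_iff_eq_neg]
    -- The vector $F_{i4}^2f+f$ does not depend on $i$, so $i$ may be chosen to suit each generator:
    -- $F_{k4}$ kills it because $F_{k4}^3=-F_{k4}$, and $F_{kl}$ kills it through a disjoint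
    -- $F_{m4}$.
    refine hF.faithful _ fun k l => ?_
    have h4 {k : Fin 5} (hk : k ≠ 4) : F k 4 *ᵥ (F i 4 *ᵥ F i 4 *ᵥ f + f) = 0 := by
      have : F i 4 *ᵥ F i 4 *ᵥ f = F k 4 *ᵥ F k 4 *ᵥ f := by
        by_cases h : i = k
        · rw [h]
        · exact heq hi hk h
      rw [this, mulVec_add, mulVec_mulVec, mulVec_mulVec, (hF.rotation k 4 hk).cube,
        neg_mulVec, neg_add_cancel]
    by_cases hk : k = 4
    · subst hk
      by_cases hl : l = 4
      · rw [hl, hF.self, zero_mulVec]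
      · rw [hF.swap l, neg_mulVec, h4 hl, neg_zero]
    by_cases hl : l = 4
    · subst hl; exact h4 hk
    by_cases hkl : k = l
    · rw [hkl, hF.self, zero_mulVec]
    obtain ⟨m, hm, hmk, hml⟩ : ∃ m : Fin 5, m ≠ 4 ∧ m ≠ k ∧ m ≠ l := by
      clear hk hl hi hkl; decide +revert
    have : F i 4 *ᵥ F i 4 *ᵥ f = F m 4 *ᵥ F m 4 *ᵥ f := by
      by_cases h : i = m
      · rw [h]
      · exact heq hi hm h
    rw [this, mulVec_add, hf k l hk hl, mulVec_mulVec,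
      hF.disjoint k l m 4 hkl hmk.symm hk hml.symm hl hm, zero_mulVec, add_zero]
  · exact hoff hi hj hij

/-- A rotation frame is intertwined with the standard one. -/
theorem exists_intertwiner (hF : IsRotationFrame F) :
    ∃ θ : Matrix (Fin 5) (Fin 5) ℂ, θ ≠ 0 ∧
      ∀ i j, θ * skewMat (Pi.single i 1) (Pi.single j 1) = F i j * θ := by
  obtain ⟨f, hf0, hf⟩ := hF.exists_fixed
  -- These columns copy the standard model, where $E_{i4}e_4=e_i$: the fixed vector $f$ plays the
  -- role of $e_4$.
  set w : Fin 5 → Fin 5 → ℂ := fun i => if i = 4 then f else F i 4 *ᵥ f with hw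
  set θ : Matrix (Fin 5) (Fin 5) ℂ := of fun k i => w i k with hθ
  have hθs (i) : θ *ᵥ Pi.single i 1 = w i := by rw [mulVec_single_one]; rfl
  have hw4 : w 4 = f := if_pos rfl
  have hw' {i} (hi : i ≠ 4) : w i = F i 4 *ᵥ f := if_neg hi
  refine ⟨θ, fun h => hf0 ?_, ?_⟩
  · rw [← hw4, ← hθs, h, zero_mulVec]
  have main {i j : Fin 5} (hi : i ≠ 4) (k) :
      (Pi.single k 1 : Fin 5 → ℂ) j • w i - (Pi.single k 1 : Fin 5 → ℂ) i • w j = F i j *ᵥ w k := by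
    by_cases hj : j = 4
    · subst hj
      by_cases hk : k = 4
      · subst hk; simp [hw4, hw' hi, hi]
      · rw [hw' hk, hF.mulVec_mulVec_fixed hf hi hk, hw4]
        by_cases hik : i = k
        · simp [hik, Ne.symm hk]
        · simp [hik, Ne.symm hk]
    · by_cases hk : k = 4
      · subst hk; simp [hw4, hi, hj, hf i j hi hj]
      · rw [hw' hk, hw' hi, hw' hj, hF.mul_mulVec i j k 4, hf i j hi hj]
        simp [hi, hj, Pi.single_apply, ite_smul]
  have main' (i j k : Fin 5) :
      (Pi.single k 1 : Fin 5 → ℂ) j • w i - (Pi.single k 1 : Fin 5 → ℂ) i • w j = F i j *ᵥ w k := by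
    by_cases hi : i = 4
    · by_cases hj : j = 4
      · rw [hi, hj, hF.self, sub_self, zero_mulVec]
      · rw [hF.swap, neg_mulVec, ← main hj, neg_sub]
    · exact main hi k
  intro i j
  refine ext_of_mulVec_single fun k => ?_
  rw [← mulVec_mulVec, ← mulVec_mulVec, hθs, skewMat_single_mulVec, mulVec_sub, mulVec_smul,
    mulVec_smul, hθs, hθs, main']

end IsRotationFrame

/-- Every automorphism of `o(5)` is conjugation by an orthogonal matrix. -/
theorem exists_eq_conjAut {L : Type*} [LieRing L] [LieAlgebra ℂ L] (e : L ≃ₗ⁅ℂ⁆ O5)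
    (φ : L ≃ₗ⁅ℂ⁆ L) : ∃ g, ∃ hg : gᵀ * g = 1, φ = conjAut e g hg := by
  obtain ⟨θ, hθ0, hθ⟩ := (isRotationFrame_aut e φ).exists_intertwiner
  have h1 (z : L) : θ * toMat e z = toMat e (φ z) * θ := by
    have hz : z = ∑ i, ∑ j, (toMat e z i j / 2) • wedge e (Pi.single i 1) (Pi.single j 1) :=
      toMat_injective e (by
        simp only [map_sum, map_smul, toMat_wedge]; exact eq_sum_skewMat (toMat_transpose e z))
    rw [hz]
    simp only [map_sum, map_smul, toMat_wedge, Finset.mul_sum, Finset.sum_mul, mul_smul_comm,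
      smul_mul_assoc, hθ]
  have h2 (z : L) : θᵀ * toMat e (φ z) = toMat e z * θᵀ := by
    have := congrArg transpose (h1 z)
    simpa [transpose_mul, toMat_transpose] using this.symm
  -- The transpose intertwines in the opposite direction, so $\theta^{T}\theta$ is scalar. The
  -- kernel of $\theta$ is stable under $o(5)$, hence zero, and a square root of $c$ normalizes
  -- $\theta$.
  obtain ⟨c, hc⟩ := exists_eq_smul_one_of_commute (N := θᵀ * θ) fun Z hZ => by
    obtain ⟨z, rfl⟩ : ∃ z, Z = toMat e z := ⟨ofMat e Z hZ, by simp⟩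
    rw [mul_assoc, h1, ← mul_assoc, h2, mul_assoc]
  have hker : LinearMap.ker θ.mulVecLin = ⊥ := by
    by_contra hne
    have := eq_top_of_skew_stable _ (fun Z hZ v hv => ?_) hne
    · rw [LinearMap.ker_eq_top] at this
      exact hθ0 (ext_of_mulVec_single fun k => by
        rw [← mulVecLin_apply, this, zero_mulVec]; rfl)
    · rw [LinearMap.mem_ker, mulVecLin_apply] at hv ⊢
      obtain ⟨z, rfl⟩ : ∃ z, Z = toMat e z := ⟨ofMat e Z hZ, by simp⟩
      rw [mulVec_mulVec, h1, ← mulVec_mulVec, hv, mulVec_zero]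
  have hc0 : c ≠ 0 := by
    rintro rfl
    have hdet : θ.det ≠ 0 := fun h => by
      obtain ⟨v, hv0, hv⟩ := exists_mulVec_eq_zero_iff.mpr h
      exact hv0 (LinearMap.ker_eq_bot'.mp hker v hv)
    have := congrArg det hc
    rw [det_mul, det_transpose, zero_smul, det_zero] at this
    exact hdet (mul_self_eq_zero.mp this)
  obtain ⟨s, hs⟩ := IsAlgClosed.exists_pow_nat_eq c (n := 2) (by norm_num)
  have hs0 : s ≠ 0 := by rintro rfl; exact hc0 (by simpa using hs.symm)
  have hg : (s⁻¹ • θ)ᵀ * (s⁻¹ • θ) = 1 := by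
    rw [transpose_smul, smul_mul_smul_comm, hc, smul_smul, ← hs]
    field_simp
    simp
  refine ⟨s⁻¹ • θ, hg, ?_⟩
  ext z
  apply toMat_injective e
  have hg' := mul_eq_one_comm.mp hg
  rw [toMat_conjAut, smul_mul_assoc, h1, ← mul_smul_comm, mul_assoc, hg', mul_one]

end

/-! ### Characters of abelian groups; gradings and their diagonal groups. -/

/-- Characters with values in `ℂ` separate the elements of an abelian group. -/
theorem exists_character_ne {A : Type*} [CommGroup A] {a b : A} (hab : a ≠ b) :
    ∃ χ : A → ℂ, (∀ x y, χ (x * y) = χ x * χ y) ∧ (∀ x, χ x ≠ 0) ∧ χ a ≠ χ b := by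
  have hne : Additive.ofMul (a / b) ≠ 0 := fun h => hab (div_eq_one.mp h)
  obtain ⟨c, hc⟩ := CharacterModule.exists_character_apply_ne_zero_of_ne_zero hne
  -- The separating character has values in $\mathbb Q/\mathbb Z$; it is carried injectively through
  -- $\mathbb R/\mathbb Z$ to the unit circle.
  let ι : AddCircle (1 : ℚ) →+ AddCircle (1 : ℝ) :=
    QuotientAddGroup.map _ _ (Rat.castHom ℝ).toAddMonoidHom (by
      rw [AddSubgroup.zmultiples_le]
      exact ⟨1, by simp⟩)
  have hι : ∀ x, ι x = 0 → x = 0 := by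
    intro x
    induction x using QuotientAddGroup.induction_on with
    | H q =>
      intro h
      obtain ⟨n, hn⟩ := (QuotientAddGroup.eq_zero_iff _).mp
        (h : ((Rat.castHom ℝ q : ℝ) : AddCircle (1 : ℝ)) = 0)
      refine (QuotientAddGroup.eq_zero_iff _).mpr ⟨n, ?_⟩
      have : ((n : ℤ) : ℝ) = (q : ℝ) := by simpa using hn
      simpa using (by exact_mod_cast this : (n : ℚ) = q)
  let χ : A → Circle := fun x => AddCircle.toCircle (ι (c (Additive.ofMul x)))
  have hmul (x y) : χ (x * y) = χ x * χ y := by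
    have : c (Additive.ofMul (x * y)) = c (Additive.ofMul x) + c (Additive.ofMul y) :=
      map_add c (Additive.ofMul x) (Additive.ofMul y)
    simp only [χ, this, map_add, AddCircle.toCircle_add]
  refine ⟨fun x => χ x, fun x y => (congrArg _ (hmul x y)).trans (Circle.coe_mul _ _), fun x => Circle.coe_ne_zero _, fun h => hc ?_⟩
  have h1 : χ a = χ b := Circle.ext h
  have h2 := AddCircle.injective_toCircle one_ne_zero h1
  apply hι
  have h3 : Additive.ofMul (a / b) = Additive.ofMul a - Additive.ofMul b := rfl
  rw [h3, map_sub, map_sub, sub_eq_zero]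
  exact h2

/-- If smaller subspaces already span, then they are not smaller. -/
theorem iSupIndep.eq_of_le_of_iSup_eq_top {ι M : Type*} [AddCommGroup M] [Module ℂ M]
    {U V : ι → Submodule ℂ M} (hV : iSupIndep V) (hUV : ∀ i, U i ≤ V i) (hU : ⨆ i, U i = ⊤)
    (i : ι) : U i = V i := by
  refine le_antisymm (hUV i) fun x hx => ?_
  have h1 : U i ⊔ ⨆ (j) (_ : j ≠ i), U j = ⊤ := by
    rw [eq_top_iff, ← hU]
    refine iSup_le fun j => ?_
    by_cases h : j = i
    · subst h; exact le_sup_left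
    · exact le_sup_of_le_right (le_iSup₂_of_le j h le_rfl)
  obtain ⟨y, hy, z, hz, rfl⟩ := Submodule.mem_sup.mp (h1 ▸ Submodule.mem_top (x := x))
  have hzV : z ∈ V i := by simpa using (V i).sub_mem hx (hUV i hy)
  have hz0 : z = 0 := by
    have := (hV i).le_bot ⟨hzV, (iSup₂_mono fun j _ => hUV j) hz⟩
    simpa using this
  rw [hz0, add_zero]; exact hy

namespace LieGrading

variable {L : Type*} [LieRing L] [LieAlgebra ℂ L]

/-- There is a linear map acting as a prescribed scalar on each subspace. -/
theorem exists_scaling (Γ : LieGrading L) (c : Γ.Idx → ℂ) :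
    ∃ T : L →ₗ[ℂ] L, ∀ j, ∀ x ∈ Γ.space j, T x = c j • x := by
  classical
  have hint := DirectSum.isInternal_submodule_of_iSupIndep_of_iSup_eq_top Γ.independent Γ.span
  let E := LinearEquiv.ofBijective (DirectSum.coeLinearMap Γ.space) hint
  refine ⟨DirectSum.toModule ℂ _ L (fun j => c j • (Γ.space j).subtype) ∘ₗ E.symm.toLinearMap,
    fun j x hx => ?_⟩
  have h1 : E (DirectSum.lof ℂ _ (fun j => Γ.space j) j ⟨x, hx⟩) = x := by
    exact DirectSum.coeLinearMap_lof _ _ _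
  have h2 : E.symm x = DirectSum.lof ℂ _ (fun j => Γ.space j) j ⟨x, hx⟩ := by
    rw [LinearEquiv.symm_apply_eq, h1]
  simp [h2]

/-- Two linear maps agreeing on all the subspaces are equal. -/
theorem linearMap_ext (Γ : LieGrading L) {N : Type*} [AddCommGroup N] [Module ℂ N]
    {f g : L →ₗ[ℂ] N} (h : ∀ j, ∀ x ∈ Γ.space j, f x = g x) : f = g := by
  have h1 : ⨆ j, Γ.space j ≤ LinearMap.eqLocus f g := iSup_le fun j x hx => h j x hx
  ext x
  exact h1 (Γ.span ▸ Submodule.mem_top)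

theorem isDiagonalizableAut_of_mem_diag (Γ : LieGrading L) {φ : L ≃ₗ⁅ℂ⁆ L} (h : φ ∈ Γ.Diag) :
    IsDiagonalizableAut φ := by
  rw [IsDiagonalizableAut, eq_top_iff, ← Γ.span]
  refine iSup_le fun j => ?_
  obtain ⟨α, hα⟩ := h j
  exact le_iSup_of_le α fun x hx => Module.End.mem_eigenspace_iff.mpr (hα x hx)

theorem commute_of_mem_diag (Γ : LieGrading L) {φ ψ : L ≃ₗ⁅ℂ⁆ L} (hφ : φ ∈ Γ.Diag)
    (hψ : ψ ∈ Γ.Diag) (x : L) : φ (ψ x) = ψ (φ x) := by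
  have h := Γ.linearMap_ext (f := (φ : L →ₗ[ℂ] L) ∘ₗ (ψ : L →ₗ[ℂ] L))
    (g := (ψ : L →ₗ[ℂ] L) ∘ₗ (φ : L →ₗ[ℂ] L)) fun j x hx => by
      obtain ⟨α, hα⟩ := hφ j
      obtain ⟨β, hβ⟩ := hψ j
      have h1 : φ (ψ x) = ψ (φ x) := by
        rw [hα x hx, hβ x hx, map_smul, map_smul, hα x hx, hβ x hx, smul_comm]
      exact h1
  exact LinearMap.congr_fun h x

/-- Any two subspaces are distinguished by the scalar by which some element of `G` acts. -/
def IsSeparatedBy (Γ : LieGrading L) (G : Set (L ≃ₗ⁅ℂ⁆ L)) : Prop :=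
  ∀ j j', j ≠ j' → ∃ φ ∈ G, ∃ α β : ℂ, α ≠ β ∧ (∀ x ∈ Γ.space j, φ x = α • x) ∧
    ∀ x ∈ Γ.space j', φ x = β • x

/-- The projections onto the subspaces commute with $G$, so all nonzero components of $x$ have the
eigenvalues of $x$. Two of them would contradict separation. -/
theorem mem_space_of_eigenvector (Γ : LieGrading L) {G : Set (L ≃ₗ⁅ℂ⁆ L)}
    (hG : G ⊆ Γ.Diag) (hs : Γ.IsSeparatedBy G) {x : L} (hx0 : x ≠ 0) (hx : ∀ φ ∈ G, ∃ c : ℂ, φ x = c • x) :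
    ∃ j, x ∈ Γ.space j := by
  classical
  choose P hP using fun j => Γ.exists_scaling (Pi.single j 1)
  have hmem (j) (y : L) : P j y ∈ Γ.space j := by
    have h1 : ⨆ j, Γ.space j ≤ (Γ.space j).comap (P j) := iSup_le fun i y hy => by
      rw [Submodule.mem_comap, hP j i y hy]
      by_cases h : i = j
      · subst h; exact Submodule.smul_mem _ _ hy
      · simp [h]
    exact h1 (Γ.span ▸ Submodule.mem_top)
  have hzero {y : L} (hy : ∀ j, P j y = 0) : y = 0 := by
    obtain ⟨s, hs⟩ := (Submodule.mem_iSup_iff_exists_finsupp _ _).mp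
      (Γ.span ▸ Submodule.mem_top : y ∈ ⨆ j, Γ.space j)
    obtain ⟨hs1, rfl⟩ := hs
    refine Finset.sum_eq_zero fun j hj => ?_
    have h2 : P j (s.sum fun _ z => z) = s j := by
      rw [Finsupp.sum, map_sum, Finset.sum_eq_single j]
      · rw [hP j j _ (hs1 j)]; simp
      · intro i _ hij; rw [hP j i _ (hs1 i)]; simp [hij]
      · intro h; rw [Finsupp.notMem_support_iff.mp h, map_zero]
    rw [← h2, hy]
  obtain ⟨j, hj⟩ : ∃ j, P j x ≠ 0 := by
    by_contra! h
    exact hx0 (hzero h)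
  have hcomm {φ : L ≃ₗ⁅ℂ⁆ L} {c α : ℂ} {i} (h1 : φ x = c • x) (hi : P i x ≠ 0) (hd : φ ∈ Γ.Diag)
      (h2 : ∀ x ∈ Γ.space i, φ x = α • x) : c = α := by
    have h3 : (φ : L →ₗ[ℂ] L) ∘ₗ P i = P i ∘ₗ (φ : L →ₗ[ℂ] L) := Γ.linearMap_ext fun k y hy => by
      obtain ⟨β, hβ⟩ := hd k
      have : φ (P i y) = P i (φ y) := by
        rw [hβ y hy, map_smul, hP i k y hy, map_smul, hβ y hy, smul_comm]
      exact this
    have h4 : φ (P i x) = P i (φ x) := LinearMap.congr_fun h3 x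
    rw [h1, map_smul, h2 _ (hmem i x)] at h4
    exact (smul_left_injective ℂ hi h4).symm
  have hx' : x = P j x := by
    rw [← sub_eq_zero]
    refine hzero fun i => ?_
    by_cases hij : i = j
    · subst hij; rw [map_sub, hP i i _ (hmem i x)]; simp
    · rw [map_sub, hP i j _ (hmem j x), Pi.single_eq_of_ne (Ne.symm hij), zero_smul, sub_zero]
      by_contra hi
      obtain ⟨φ, hφ, α, β, hαβ, h1, h2⟩ := hs i j hij
      obtain ⟨c, hc⟩ := hx φ hφ
      exact hαβ ((hcomm hc hi (hG hφ) h1).symm.trans (hcomm hc hj (hG hφ) h2))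
  rw [hx']
  exact ⟨j, hmem j x⟩

theorem eq_of_mem_space (Γ : LieGrading L) {j j' : Γ.Idx} {x : L} (hx0 : x ≠ 0)
    (h : x ∈ Γ.space j) (h' : x ∈ Γ.space j') : j = j' := by
  by_contra hne
  exact hx0 (by simpa using (Γ.independent.pairwiseDisjoint hne).le_bot ⟨h, h'⟩)

theorem exists_ne_zero (Γ : LieGrading L) (j : Γ.Idx) : ∃ x ∈ Γ.space j, x ≠ 0 :=
  (Γ.space j).ne_bot_iff.mp (Γ.ne_bot j)

/-- A separating family of automorphisms recovers the subspaces as simultaneous eigenspaces. -/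
theorem space_eq_iInf_eigenspace (Γ : LieGrading L) {G : Set (L ≃ₗ⁅ℂ⁆ L)} (hG : G ⊆ Γ.Diag)
    (hs : Γ.IsSeparatedBy G) {χ : (L ≃ₗ⁅ℂ⁆ L) → ℂ} {j : Γ.Idx} {x : L} (hx0 : x ≠ 0)
    (hxj : x ∈ Γ.space j) (hx : ∀ φ ∈ G, φ x = χ φ • x) :
    Γ.space j = ⨅ g ∈ G, Module.End.eigenspace (g : L →ₗ[ℂ] L) (χ g) := by
  have key {y : L} : y ∈ (⨅ g ∈ G, Module.End.eigenspace (g : L →ₗ[ℂ] L) (χ g)) ↔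
      ∀ φ ∈ G, φ y = χ φ • y := by
    simp only [Submodule.mem_iInf, Module.End.mem_eigenspace_iff]
    rfl
  have hχ {φ} (hφ : φ ∈ G) : ∀ y ∈ Γ.space j, φ y = χ φ • y := by
    obtain ⟨α, hα⟩ := hG hφ j
    have : α = χ φ := smul_left_injective ℂ hx0 ((hα x hxj).symm.trans (hx φ hφ))
    exact this ▸ hα
  ext y
  rw [key]
  refine ⟨fun hy φ hφ => hχ hφ y hy, fun hy => ?_⟩
  by_cases hy0 : y = 0
  · rw [hy0]; exact zero_mem _
  obtain ⟨j', hj'⟩ := Γ.mem_space_of_eigenvector hG hs hy0 fun φ hφ => ⟨_, hy φ hφ⟩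
  by_cases hne : j = j'
  · rwa [hne]
  obtain ⟨φ, hφ, α, β, hαβ, h1, h2⟩ := hs j j' hne
  exact absurd ((smul_left_injective ℂ hx0 ((h1 x hxj).symm.trans (hx φ hφ))).trans
    (smul_left_injective ℂ hy0 ((hy φ hφ).symm.trans (h2 y hj')))) hαβ

theorem isGeneratedBy_of_isSeparatedBy (Γ : LieGrading L) {G : Set (L ≃ₗ⁅ℂ⁆ L)}
    (hG : G ⊆ Γ.Diag) (hs : Γ.IsSeparatedBy G) : Γ.IsGeneratedBy G := by
  ext W
  constructor
  · rintro ⟨j, rfl⟩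
    obtain ⟨x, hxj, hx0⟩ := Γ.exists_ne_zero j
    refine ⟨Γ.ne_bot j, ?_⟩
    classical
    refine ⟨fun φ => if h : φ ∈ G then (hG h j).choose else 0,
      Γ.space_eq_iInf_eigenspace hG hs hx0 hxj fun φ hφ => ?_⟩
    rw [dif_pos hφ]
    exact (hG hφ j).choose_spec x hxj
  · rintro ⟨hW, χ, rfl⟩
    obtain ⟨x, hx, hx0⟩ := Submodule.ne_bot_iff _ |>.mp hW
    have hx' : ∀ φ ∈ G, φ x = χ φ • x := by
      simp only [Submodule.mem_iInf, Module.End.mem_eigenspace_iff] at hx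
      exact hx
    obtain ⟨j, hj⟩ := Γ.mem_space_of_eigenvector hG hs hx0 fun φ hφ => ⟨_, hx' φ hφ⟩
    exact ⟨j, Γ.space_eq_iInf_eigenspace hG hs hx0 hj hx'⟩

theorem diag_eq_of_isMADGroup (Γ : LieGrading L) {G : Set (L ≃ₗ⁅ℂ⁆ L)} (hG : G ⊆ Γ.Diag)
    (hM : IsMADGroup G) : Γ.Diag = G :=
  Set.Subset.antisymm (fun φ hφ => hM.maximal φ (Γ.isDiagonalizableAut_of_mem_diag hφ)
    fun _ hψ x => Γ.commute_of_mem_diag hφ (hG hψ) x) hG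

/-- The automorphism given by a character of the grading group. -/
theorem exists_mem_diag_of_character (Γ : LieGrading L) {A : Type} [CommGroup A]
    {deg : Γ.Idx → A} (hdeg : ∀ j k, (∃ x ∈ Γ.space j, ∃ y ∈ Γ.space k, ⁅x, y⁆ ≠ 0) →
      ∃ l, deg l = deg j * deg k ∧ ∀ x ∈ Γ.space j, ∀ y ∈ Γ.space k, ⁅x, y⁆ ∈ Γ.space l)
    {χ : A → ℂ} (hmul : ∀ x y, χ (x * y) = χ x * χ y) (hχ : ∀ x, χ x ≠ 0) :
    ∃ φ : L ≃ₗ⁅ℂ⁆ L, ∀ j, ∀ x ∈ Γ.space j, φ x = χ (deg j) • x := by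
  obtain ⟨T, hT⟩ := Γ.exists_scaling fun j => χ (deg j)
  obtain ⟨S, hS⟩ := Γ.exists_scaling fun j => (χ (deg j))⁻¹
  have hTS : T ∘ₗ S = LinearMap.id := Γ.linearMap_ext fun j x hx => by
    simp [hS j x hx, hT j x hx, hχ]
  have hST : S ∘ₗ T = LinearMap.id := Γ.linearMap_ext fun j x hx => by
    simp [hS j x hx, hT j x hx, hχ]
  let br : L →ₗ[ℂ] L →ₗ[ℂ] L := (LieModule.toEnd ℂ L L : L →ₗ[ℂ] L →ₗ[ℂ] L)
  have hlie : ∀ x y, T ⁅x, y⁆ = ⁅T x, T y⁆ := by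
    have h1 : br.compr₂ T = br.compl₁₂ T T := Γ.linearMap_ext fun j x hx =>
      Γ.linearMap_ext fun k y hy => by
        change T ⁅x, y⁆ = ⁅T x, T y⁆
        rw [hT j x hx, hT k y hy, smul_lie, lie_smul]
        by_cases h0 : ⁅x, y⁆ = 0
        · simp [h0]
        · obtain ⟨l, hl, hl'⟩ := hdeg j k ⟨x, hx, y, hy, h0⟩
          rw [hT l _ (hl' x hx y hy), hl, hmul, mul_smul]
    exact fun x y => LinearMap.congr_fun (LinearMap.congr_fun h1 x) y
  exact ⟨{ T with
    map_lie' := fun {x y} => hlie x y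
    invFun := S
    left_inv := LinearMap.congr_fun hST
    right_inv := LinearMap.congr_fun hTS }, hT⟩

/-- This is where the group matters: distinct degrees are separated by a character, and each
character acts on $L$ as a diagonal automorphism. -/
theorem IsGroupGrading.isSeparatedBy_diag {Γ : LieGrading L} (h : Γ.IsGroupGrading) :
    Γ.IsSeparatedBy Γ.Diag := by
  obtain ⟨A, _, deg, hinj, hdeg⟩ := h
  intro j j' hne
  obtain ⟨χ, hmul, h0, hχ⟩ := exists_character_ne (hinj.ne hne)
  obtain ⟨φ, hφ⟩ := Γ.exists_mem_diag_of_character hdeg hmul h0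
  exact ⟨φ, fun i => ⟨_, hφ i⟩, _, _, hχ, hφ j, hφ j'⟩

/-- If a grading is diagonalized by a family separating another one, it refines the other one. -/
theorem exists_le_of_isSeparatedBy {Γ Γ' : LieGrading L} {C : Set (L ≃ₗ⁅ℂ⁆ L)}
    (hC : C ⊆ Γ.Diag) (hs : Γ.IsSeparatedBy C) (hC' : C ⊆ Γ'.Diag) :
    ∃ p : Γ'.Idx → Γ.Idx, ∀ i, Γ'.space i ≤ Γ.space (p i) := by
  have h (i : Γ'.Idx) : ∃ j, Γ'.space i ≤ Γ.space j := by
    obtain ⟨x, hx, hx0⟩ := Γ'.exists_ne_zero i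
    choose! χ hχ using fun φ (hφ : φ ∈ C) => hC' hφ i
    obtain ⟨j, hj⟩ := Γ.mem_space_of_eigenvector hC hs hx0 fun φ hφ => ⟨_, hχ φ hφ x hx⟩
    refine ⟨j, ?_⟩
    rw [Γ.space_eq_iInf_eigenspace hC hs hx0 hj fun φ hφ => hχ φ hφ x hx]
    intro y hy
    simp only [Submodule.mem_iInf, Module.End.mem_eigenspace_iff]
    exact fun φ hφ => hχ φ hφ y hy
  choose p hp using h
  exact ⟨p, hp⟩

theorem isRefinement_of_le {Γ Γ' : LieGrading L} {p : Γ'.Idx → Γ.Idx}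
    (hp : ∀ i, Γ'.space i ≤ Γ.space (p i)) : Γ'.IsRefinement Γ := by
  refine ⟨p, fun j => (Γ.independent.eq_of_le_of_iSup_eq_top
    (U := fun j => ⨆ i : {i // p i = j}, Γ'.space i) (fun j => ?_) ?_ j).symm⟩
  · exact iSup_le fun ⟨i, hi⟩ => hi ▸ hp i
  · rw [eq_top_iff, ← Γ'.span]
    exact iSup_le fun i => le_iSup_of_le (p i) (le_iSup_of_le ⟨i, rfl⟩ le_rfl)

theorem isSame_of_mutual_le {Γ Γ' : LieGrading L} {p : Γ'.Idx → Γ.Idx} {q : Γ.Idx → Γ'.Idx}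
    (hp : ∀ i, Γ'.space i ≤ Γ.space (p i)) (hq : ∀ j, Γ.space j ≤ Γ'.space (q j)) :
    Γ'.IsSame Γ := by
  have hqp (i) : q (p i) = i := by
    obtain ⟨x, hx, hx0⟩ := Γ'.exists_ne_zero i
    exact Γ'.eq_of_mem_space hx0 (hq _ (hp _ hx)) hx
  have hpq (j) : p (q j) = j := by
    obtain ⟨x, hx, hx0⟩ := Γ.exists_ne_zero j
    exact Γ.eq_of_mem_space hx0 (hp _ (hq _ hx)) hx
  exact ⟨⟨p, q, hqp, hpq⟩, fun i => le_antisymm (hp i) (by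
    have := hq (p i); rwa [hqp] at this)⟩

/-- Passing to a refinement $\Gamma'$ keeps $G$ diagonal, and maximality gives
$\operatorname{Diag}\Gamma'=G$. As $\operatorname{Diag}\Gamma'$ separates the pieces of $\Gamma'$
and is diagonal on $\Gamma$, the grading $\Gamma$ refines $\Gamma'$ in turn. -/
theorem isFineGroupGrading_of_isMADGroup {Γ : LieGrading L} (hΓ : Γ.IsGroupGrading)
    {G : Set (L ≃ₗ⁅ℂ⁆ L)} (hM : IsMADGroup G) (hG : G ⊆ Γ.Diag) : Γ.IsFineGroupGrading := by
  refine ⟨hΓ, fun Γ' hΓ' ⟨p, hp⟩ => ?_⟩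
  have hle (i) : Γ'.space i ≤ Γ.space (p i) := by
    rw [hp]; exact le_iSup_of_le ⟨i, rfl⟩ le_rfl
  have h1 : G ⊆ Γ'.Diag := fun φ hφ i => by
    obtain ⟨α, hα⟩ := hG hφ (p i)
    exact ⟨α, fun x hx => hα x (hle i hx)⟩
  have h2 : Γ'.Diag ⊆ Γ.Diag := by rw [Γ'.diag_eq_of_isMADGroup h1 hM]; exact hG
  obtain ⟨q, hq⟩ := exists_le_of_isSeparatedBy subset_rfl hΓ'.isSeparatedBy_diag h2
  exact isSame_of_mutual_le hle hq

theorem IsFineGroupGrading.isSame {Δ Γ : LieGrading L} (hΔ : Δ.IsFineGroupGrading)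
    (hΓ : Γ.IsGroupGrading) (h : Δ.Diag ⊆ Γ.Diag) : Γ.IsSame Δ := by
  obtain ⟨p, hp⟩ := exists_le_of_isSeparatedBy subset_rfl hΔ.1.isSeparatedBy_diag h
  exact hΔ.2 Γ hΓ (isRefinement_of_le hp)

theorem IsSame.isEquivalent {Δ Γ Γ' : LieGrading L} (h : Γ.IsSame Δ) (h' : Γ.IsEquivalent Γ') :
    Δ.IsEquivalent Γ' := by
  obtain ⟨s, hs⟩ := h
  obtain ⟨φ, π, hφ⟩ := h'
  refine ⟨φ, s.symm.trans π, fun j => ?_⟩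
  rw [← s.apply_symm_apply j, ← hs, hφ]; simp

theorem IsEquivalent.areConjugate_diag {Γ Γ' : LieGrading L} (h : Γ.IsEquivalent Γ') :
    AreConjugate Γ.Diag Γ'.Diag := by
  obtain ⟨φ, π, hφ⟩ := h
  have hmem {j} {x : L} : φ x ∈ Γ'.space (π j) ↔ x ∈ Γ.space j := by
    rw [← hφ]
    refine ⟨?_, fun hx => ⟨x, hx, rfl⟩⟩
    rintro ⟨y, hy, hyx⟩
    rwa [← φ.injective hyx]
  refine ⟨φ, Set.Subset.antisymm ?_ fun ψ hψ => ⟨(φ.trans ψ).trans φ.symm, fun j => ?_, ?_⟩⟩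
  · rintro _ ⟨ψ, hψ, rfl⟩ j
    obtain ⟨j, rfl⟩ := π.surjective j
    obtain ⟨α, hα⟩ := hψ j
    refine ⟨α, fun x hx => ?_⟩
    obtain ⟨y, rfl⟩ : ∃ y, φ y = x := ⟨φ.symm x, φ.apply_symm_apply x⟩
    change φ (ψ (φ.symm (φ y))) = _
    rw [φ.symm_apply_apply, hα y (hmem.mp hx), map_smul]
  · obtain ⟨α, hα⟩ := hψ (π j)
    refine ⟨α, fun x hx => ?_⟩
    change φ.symm (ψ (φ x)) = _
    rw [hα _ (hmem.mpr hx), ← map_smul, φ.symm_apply_apply]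
  · ext x
    change φ (φ.symm (ψ (φ (φ.symm x)))) = _
    simp

end LieGrading

/-! ### Adapted bases and their weight gradings. -/

section

open Matrix

/-- The three types of hyperbolic-orthonormal bases, encoded by the pairing of the basis vectors. -/
def pairing : Fin 3 → Fin 5 → Fin 5 := ![![1, 0, 3, 2, 4], ![1, 0, 2, 3, 4], ![0, 1, 2, 3, 4]]

/-- The weights of the basis vectors. -/
def weight (k : Fin 3) (i m : Fin 5) : ZMod 4 :=
  -- Coordinate $m$ records exponents of the primitive fourth root of unity: a diagonal orthogonal
  -- matrix with eigenvalue $i$ on $b_m$ and $i^{-1}$ on its partner, or $-1$ on a self-paired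
  -- $b_m$, and $1$ elsewhere. Finite weights make the combinatorial lemmas decidable.
  if i = m then (if pairing k m = m then 2 else 1) else if i = pairing k m then 3 else 0

theorem pairing_pairing : ∀ k i, pairing k (pairing k i) = i := by decide

theorem weight_add_weight_pairing : ∀ k i, weight k i + weight k (pairing k i) = 0 := by decide

theorem eq_pairing_of_weight_add_eq_zero :
    ∀ k i j, i ≠ j → weight k i + weight k j = 0 → j = pairing k i := by decide

-- Only hyperbolic pairs can share a weight, namely zero. This is the source of the single
-- two-dimensional subspace, for two hyperbolic pairs.
set_option maxRecDepth 100000 in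
theorem eq_or_of_weight_add_eq : ∀ k, ∀ i j, i < j → ∀ i' j', i' < j' →
    weight k i + weight k j = weight k i' + weight k j' →
    (i = i' ∧ j = j') ∨ (j = pairing k i ∧ j' = pairing k i') := by decide

/-- A basis of `ℂ⁵` consisting of hyperbolic pairs and orthonormal vectors, as prescribed by the
pairing. -/
def IsAdaptedBasis (k : Fin 3) (b : Fin 5 → Fin 5 → ℂ) : Prop :=
  ∀ i j, b i ⬝ᵥ b j = if j = pairing k i then 1 else 0

/-- The permutation matrix of the pairing. -/
def pairingMat (k : Fin 3) : Matrix (Fin 5) (Fin 5) ℂ :=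
  of fun i j => if j = pairing k i then 1 else 0

theorem pairingMat_mul_apply (k : Fin 3) (A : Matrix (Fin 5) (Fin 5) ℂ) (i j : Fin 5) :
    (pairingMat k * A) i j = A (pairing k i) j := by
  simp [pairingMat, Matrix.mul_apply]

theorem pairingMat_mul_self (k : Fin 3) : pairingMat k * pairingMat k = 1 := by
  ext i j
  rw [pairingMat_mul_apply]
  simp [pairingMat, pairing_pairing, Matrix.one_apply, eq_comm]

namespace IsAdaptedBasis

variable {k : Fin 3} {b b' : Fin 5 → Fin 5 → ℂ}

theorem mul_transpose (hb : IsAdaptedBasis k b) : of b * (of b)ᵀ = pairingMat k := by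
  ext i j
  exact hb i j

theorem transpose_mul_mul (hb : IsAdaptedBasis k b) : (of b)ᵀ * pairingMat k * of b = 1 := by
  rw [mul_eq_one_comm, ← mul_assoc, hb.mul_transpose, pairingMat_mul_self]

/-- The partners of the basis vectors form the dual basis. -/
theorem eq_sum (hb : IsAdaptedBasis k b) (v : Fin 5 → ℂ) :
    v = ∑ i, (b (pairing k i) ⬝ᵥ v) • b i := by
  have h := congrArg (· *ᵥ v) hb.transpose_mul_mul
  simp only [one_mulVec, ← mulVec_mulVec] at h
  conv_lhs => rw [← h]
  ext m
  rw [mulVec_mulVec, mulVec_mulVec, mul_assoc, ← mulVec_mulVec]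
  simp only [mulVec, dotProduct, transpose_apply, of_apply, Finset.sum_apply, Pi.smul_apply,
    pairingMat_mul_apply, smul_eq_mul, mul_comm]

/-- Any two adapted bases of the same type are related by an orthogonal matrix. -/
theorem exists_orthogonal (hb : IsAdaptedBasis k b) (hb' : IsAdaptedBasis k b') :
    ∃ g : Matrix (Fin 5) (Fin 5) ℂ, gᵀ * g = 1 ∧ ∀ i, g *ᵥ b i = b' i := by
  have hs : (pairingMat k)ᵀ = pairingMat k := by
    rw [← hb.mul_transpose, transpose_mul, transpose_transpose]
  refine ⟨(of b')ᵀ * pairingMat k * of b, ?_, fun i => ?_⟩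
  · simp only [transpose_mul, transpose_transpose, hs]
    calc _ = (of b)ᵀ * pairingMat k * (of b' * (of b')ᵀ) * pairingMat k * of b := by
          simp only [mul_assoc]
      _ = (of b)ᵀ * (pairingMat k * pairingMat k) * pairingMat k * of b := by
          rw [hb'.mul_transpose]; simp only [mul_assoc]
      _ = 1 := by rw [pairingMat_mul_self, mul_one, hb.transpose_mul_mul]
  · have h1 : ((of b')ᵀ * pairingMat k * of b) * (of b)ᵀ = (of b')ᵀ := by
      rw [mul_assoc, hb.mul_transpose, mul_assoc, pairingMat_mul_self, mul_one]
    ext m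
    exact congrFun (congrFun h1 m) i

theorem smul (hb : IsAdaptedBasis k b) {c : Fin 5 → ℂ} (hc : ∀ i, c i * c (pairing k i) = 1) :
    IsAdaptedBasis k fun i => c i • b i := fun i j => by
  rw [smul_dotProduct, dotProduct_smul, hb i j]
  split_ifs with h
  · subst h; simpa using hc i
  · simp

theorem mul_eq_one_of_mulVec_eq (hb : IsAdaptedBasis k b) {g : Matrix (Fin 5) (Fin 5) ℂ}
    (hg : gᵀ * g = 1) {c : Fin 5 → ℂ} (hc : ∀ i, g *ᵥ b i = c i • b i) (i : Fin 5) :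
    c i * c (pairing k i) = 1 := by
  have h1 : g *ᵥ b i ⬝ᵥ g *ᵥ b (pairing k i) = b i ⬝ᵥ b (pairing k i) := by
    rw [dotProduct_mulVec, ← mulVec_transpose, mulVec_mulVec, hg, one_mulVec]
  rw [hc, hc, smul_dotProduct, dotProduct_smul, hb, if_pos rfl] at h1
  simpa using h1

end IsAdaptedBasis

/-- The standard adapted bases. -/
noncomputable def stdAdapted : Fin 3 → Fin 5 → Fin 5 → ℂ :=
  ![![![1, Complex.I, 0, 0, 0], ![1 / 2, -Complex.I / 2, 0, 0, 0], ![0, 0, 1, Complex.I, 0],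
      ![0, 0, 1 / 2, -Complex.I / 2, 0], ![0, 0, 0, 0, 1]],
    ![![1, Complex.I, 0, 0, 0], ![1 / 2, -Complex.I / 2, 0, 0, 0], ![0, 0, 1, 0, 0],
      ![0, 0, 0, 1, 0], ![0, 0, 0, 0, 1]],
    ![![1, 0, 0, 0, 0], ![0, 1, 0, 0, 0], ![0, 0, 1, 0, 0], ![0, 0, 0, 1, 0], ![0, 0, 0, 0, 1]]]

theorem isAdaptedBasis_stdAdapted (k : Fin 3) : IsAdaptedBasis k (stdAdapted k) := by
  intro i j
  fin_cases k <;> fin_cases i <;> fin_cases j <;>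
    simp [stdAdapted, pairing, dotProduct, Fin.sum_univ_five] <;> ring_nf <;>
    simp [Complex.I_sq] <;> norm_num

section
variable {L : Type*} [LieRing L] [LieAlgebra ℂ L] (e : L ≃ₗ⁅ℂ⁆ O5)

/-- Increasing pairs of indices. -/
abbrev IncPair : Type := {p : Fin 5 × Fin 5 // p.1 < p.2}

theorem mem_span_wedge {b : Fin 5 → Fin 5 → ℂ} {k : Fin 3} (hb : IsAdaptedBasis k b) (x : L) :
    x ∈ Submodule.span ℂ (Set.range fun p : IncPair => wedge e (b p.1.1) (b p.1.2)) := by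
  set S := Submodule.span ℂ (Set.range fun p : IncPair => wedge e (b p.1.1) (b p.1.2))
  have h1 (i j : Fin 5) : wedge e (b i) (b j) ∈ S := by
    rcases lt_trichotomy i j with h | h | h
    · exact Submodule.subset_span ⟨⟨(i, j), h⟩, rfl⟩
    · rw [h, wedge_self]; exact S.zero_mem
    · rw [wedge_swap]; exact S.neg_mem (Submodule.subset_span ⟨⟨(j, i), h⟩, rfl⟩)
  have h2 (u v : Fin 5 → ℂ) : wedge e u v ∈ S := by
    rw [hb.eq_sum u, hb.eq_sum v]
    simp only [map_sum, LinearMap.sum_apply, map_smul, LinearMap.smul_apply]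
    exact S.sum_mem fun i _ => S.smul_mem _ (S.sum_mem fun j _ => S.smul_mem _ (h1 _ _))
  have hx : x = ∑ i, ∑ j, (toMat e x i j / 2) • wedge e (Pi.single i 1) (Pi.single j 1) :=
    toMat_injective e (by
      simp only [map_sum, map_smul, toMat_wedge]; exact eq_sum_skewMat (toMat_transpose e x))
  rw [hx]
  exact S.sum_mem fun i _ => S.sum_mem fun j _ => S.smul_mem _ (h2 _ _)

/-- The coordinates of a bivector. -/
theorem dotProduct_toMat_wedge {b : Fin 5 → Fin 5 → ℂ} {k : Fin 3} (hb : IsAdaptedBasis k b)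
    (i j i' j' : Fin 5) :
    b (pairing k i') ⬝ᵥ toMat e (wedge e (b i) (b j)) *ᵥ b (pairing k j') =
      (if i = i' ∧ j = j' then 1 else 0) - (if i = j' ∧ j = i' then 1 else 0) := by
  rw [toMat_wedge, skewMat_mulVec, dotProduct_sub, dotProduct_smul, dotProduct_smul]
  simp only [hb _ _, pairing_pairing]
  have h (a c : Fin 5) : (pairing k a = pairing k c) ↔ c = a :=
    ⟨fun h => by rw [← pairing_pairing k c, ← h, pairing_pairing], fun h => by rw [h]⟩
  simp only [h, smul_eq_mul]
  split_ifs <;> simp_all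

theorem linearIndependent_wedge {b : Fin 5 → Fin 5 → ℂ} {k : Fin 3} (hb : IsAdaptedBasis k b) :
    LinearIndependent ℂ fun p : IncPair => wedge e (b p.1.1) (b p.1.2) := by
  rw [Fintype.linearIndependent_iff]
  intro c hc q
  have h1 := congrArg (fun x => b (pairing k q.1.1) ⬝ᵥ toMat e x *ᵥ b (pairing k q.1.2)) hc
  simp only [map_sum, map_smul, sum_mulVec, smul_mulVec, dotProduct_sum, dotProduct_smul,
    dotProduct_toMat_wedge e hb, map_zero, zero_mulVec, dotProduct_zero] at h1
  rw [Finset.sum_eq_single q] at h1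
  · have : ¬ (q.1.1 = q.1.2 ∧ q.1.2 = q.1.1) := fun h => q.2.ne h.1
    simpa [this] using h1
  · rintro p - hpq
    have h2 : ¬ (p.1.1 = q.1.1 ∧ p.1.2 = q.1.2) := fun h => hpq (Subtype.ext (Prod.ext h.1 h.2))
    have h3 : ¬ (p.1.1 = q.1.2 ∧ p.1.2 = q.1.1) := fun h => by
      have h4 := p.2; rw [h.1, h.2] at h4; exact lt_asymm h4 q.2
    simp [h2, h3]
  · simp

/-- The basis of `L` consisting of the bivectors of an adapted basis. -/
noncomputable def wedgeBasis {b : Fin 5 → Fin 5 → ℂ} {k : Fin 3} (hb : IsAdaptedBasis k b) :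
    Module.Basis IncPair ℂ L :=
  Module.Basis.mk (linearIndependent_wedge e hb) fun x _ => mem_span_wedge e hb x

@[simp]
theorem wedgeBasis_apply {b : Fin 5 → Fin 5 → ℂ} {k : Fin 3} (hb : IsAdaptedBasis k b)
    (p : IncPair) : wedgeBasis e hb p = wedge e (b p.1.1) (b p.1.2) :=
  Module.Basis.mk_apply _ _ p

/-- The weight of a pair of basis vectors. -/
def pairWeight (k : Fin 3) (p : IncPair) : Fin 5 → ZMod 4 := weight k p.1.1 + weight k p.1.2

/-- The subspace spanned by the bivectors of a given weight. -/
noncomputable def weightSpace {b : Fin 5 → Fin 5 → ℂ} {k : Fin 3} (hb : IsAdaptedBasis k b)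
    (x : Fin 5 → ZMod 4) : Submodule ℂ L :=
  Submodule.span ℂ (wedgeBasis e hb '' {p | pairWeight k p = x})

theorem wedge_mem_weightSpace {b : Fin 5 → Fin 5 → ℂ} {k : Fin 3} (hb : IsAdaptedBasis k b)
    (i j : Fin 5) : wedge e (b i) (b j) ∈ weightSpace e hb (weight k i + weight k j) := by
  have h1 {i j : Fin 5} (h : i < j) :
      wedge e (b i) (b j) ∈ weightSpace e hb (weight k i + weight k j) :=
    Submodule.subset_span ⟨⟨(i, j), h⟩, rfl, by simp⟩
  rcases lt_trichotomy i j with h | h | h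
  · exact h1 h
  · rw [h, wedge_self]; exact zero_mem _
  · rw [wedge_swap, add_comm]; exact neg_mem (h1 h)

/-- Each term of the bracket of two bivectors contracts a pair $b_i\cdot b_j$, which is nonzero only
if the two weights cancel. Hence the total weight is preserved. -/
theorem lie_mem_weightSpace {b : Fin 5 → Fin 5 → ℂ} {k : Fin 3} (hb : IsAdaptedBasis k b)
    {w₁ w₂ : Fin 5 → ZMod 4} {x y : L} (hx : x ∈ weightSpace e hb w₁)
    (hy : y ∈ weightSpace e hb w₂) : ⁅x, y⁆ ∈ weightSpace e hb (w₁ + w₂) := by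
  have hgen (i j m n : Fin 5) : ⁅wedge e (b i) (b j), wedge e (b m) (b n)⁆ ∈
      weightSpace e hb (weight k i + weight k j + (weight k m + weight k n)) := by
    have ht (i j m n : Fin 5) (w) (hw : w = weight k i + weight k j + (weight k m + weight k n)) :
        (b i ⬝ᵥ b j) • wedge e (b m) (b n) ∈ weightSpace e hb w := by
      rw [hb i j]
      split_ifs with h
      · rw [hw, h, weight_add_weight_pairing, zero_add, one_smul]
        exact wedge_mem_weightSpace e hb m n
      · rw [zero_smul]; exact zero_mem _
    rw [lie_wedge_wedge]
    exact sub_mem (add_mem (sub_mem (ht _ _ _ _ _ (by abel)) (ht _ _ _ _ _ (by abel)))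
      (ht _ _ _ _ _ (by abel))) (ht _ _ _ _ _ (by abel))
  induction hx using Submodule.span_induction with
  | mem x hx =>
    obtain ⟨p, rfl, rfl⟩ := hx
    induction hy using Submodule.span_induction with
    | mem y hy =>
      obtain ⟨q, rfl, rfl⟩ := hy
      simp only [wedgeBasis_apply]
      exact hgen _ _ _ _
    | zero => simp
    | add y z _ _ hy hz => rw [lie_add]; exact add_mem hy hz
    | smul c y _ hy => rw [lie_smul]; exact Submodule.smul_mem _ _ hy
  | zero => simp
  | add x z _ _ hx hz => rw [add_lie]; exact add_mem hx hz
  | smul c x _ hx => rw [smul_lie]; exact Submodule.smul_mem _ _ hx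

theorem weightSpace_eq_bot {b : Fin 5 → Fin 5 → ℂ} {k : Fin 3} (hb : IsAdaptedBasis k b)
    {w : Fin 5 → ZMod 4} (hw : ¬ ∃ p, pairWeight k p = w) : weightSpace e hb w = ⊥ := by
  have : {p | pairWeight k p = w} = ∅ := Set.eq_empty_iff_forall_notMem.mpr fun p hp => hw ⟨p, hp⟩
  rw [weightSpace, this, Set.image_empty, Submodule.span_empty]

theorem mem_weightSpace_iff {b : Fin 5 → Fin 5 → ℂ} {k : Fin 3} (hb : IsAdaptedBasis k b)
    {w : Fin 5 → ZMod 4} {x : L} :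
    x ∈ weightSpace e hb w ↔ ∀ p, pairWeight k p ≠ w → (wedgeBasis e hb).repr x p = 0 := by
  rw [weightSpace, Module.Basis.mem_span_image]
  constructor
  · intro h p hp
    by_contra hne
    exact hp (h (Finsupp.mem_support_iff.mpr hne))
  · intro h p hp
    by_contra hne
    exact Finsupp.mem_support_iff.mp hp (h p hne)

theorem finrank_weightSpace {b : Fin 5 → Fin 5 → ℂ} {k : Fin 3} (hb : IsAdaptedBasis k b)
    (w : Fin 5 → ZMod 4) : Module.finrank ℂ (weightSpace e hb w) =
      Fintype.card {p : IncPair // pairWeight k p = w} := by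
  have h : LinearIndependent ℂ fun p : {p : IncPair // pairWeight k p = w} => wedgeBasis e hb p :=
    (wedgeBasis e hb).linearIndependent.comp _ Subtype.val_injective
  have hr : wedgeBasis e hb '' {p | pairWeight k p = w} =
      Set.range fun p : {p : IncPair // pairWeight k p = w} => wedgeBasis e hb p := by
    ext x
    simp only [Set.mem_image, Set.mem_ofPred_eq, Set.mem_range, Subtype.exists, exists_prop]
  rw [← finrank_span_eq_card h, weightSpace, hr]

/-- The grading of `L` by the weights of an adapted basis. -/
noncomputable def adaptedGrading {b : Fin 5 → Fin 5 → ℂ} {k : Fin 3} (hb : IsAdaptedBasis k b) :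
    LieGrading L where
  Idx := {w : Fin 5 → ZMod 4 // ∃ p, pairWeight k p = w}
  space w := weightSpace e hb w
  ne_bot := fun ⟨w, p, hp⟩ => Submodule.ne_bot_iff _ |>.mpr
    ⟨wedgeBasis e hb p, Submodule.subset_span ⟨p, hp, rfl⟩, (wedgeBasis e hb).ne_zero p⟩
  independent := by
    intro w
    have hle : ⨆ (w') (_ : w' ≠ w), weightSpace e hb w'.1 ≤
        Submodule.span ℂ (wedgeBasis e hb '' {p | pairWeight k p ≠ w.1}) :=
      iSup₂_le fun w' hw' => Submodule.span_mono (Set.image_mono fun p hp h =>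
        hw' (Subtype.ext ((hp : _ = _).symm.trans h)))
    have hdis : Disjoint {p | pairWeight k p = w.1} {p | pairWeight k p ≠ w.1} :=
      Set.disjoint_left.mpr fun p hp hp' => hp' hp
    exact ((wedgeBasis e hb).linearIndependent.disjoint_span_image hdis).mono_right hle
  span := by
    rw [eq_top_iff, ← (wedgeBasis e hb).span_eq, Submodule.span_le]
    rintro _ ⟨p, rfl⟩
    exact Submodule.mem_iSup_of_mem ⟨_, p, rfl⟩ (Submodule.subset_span ⟨p, rfl, rfl⟩)
  bracket := fun w w' => by
    by_cases h : ∃ p, pairWeight k p = w.1 + w'.1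
    · exact ⟨⟨_, h⟩, fun x hx y hy => lie_mem_weightSpace e hb hx hy⟩
    -- The sum is not a weight, so the bracket vanishes and any index will do.
    · refine ⟨w, fun x hx y hy => ?_⟩
      have := lie_mem_weightSpace e hb hx hy
      rw [weightSpace_eq_bot e hb h, Submodule.mem_bot] at this
      rw [this]; exact zero_mem _

theorem isGroupGrading_adaptedGrading {b : Fin 5 → Fin 5 → ℂ} {k : Fin 3}
    (hb : IsAdaptedBasis k b) : (adaptedGrading e hb).IsGroupGrading := by
  refine ⟨Multiplicative (Fin 5 → ZMod 4), inferInstance, fun w => Multiplicative.ofAdd w.1,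
    fun w w' h => Subtype.ext (Multiplicative.ofAdd.injective h), ?_⟩
  rintro w w' ⟨x, hx, y, hy, hxy⟩
  by_cases h : ∃ p, pairWeight k p = w.1 + w'.1
  · exact ⟨⟨_, h⟩, rfl, fun x hx y hy => lie_mem_weightSpace e hb hx hy⟩
  · have := lie_mem_weightSpace e hb hx hy
    rw [weightSpace_eq_bot e hb h, Submodule.mem_bot] at this
    exact absurd this hxy

end

end

/-! ### Diagonal groups of adapted bases: maximality and conjugacy. -/

section

open Matrix

section
variable {L : Type*} [LieRing L] [LieAlgebra ℂ L] (e : L ≃ₗ⁅ℂ⁆ O5)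

/-- If the conjugations commute, Schur's lemma gives $gd=c\,dg$. Orthogonality yields $c^2=1$ and
the determinant $c^5=1$, so $c=1$; this uses that 5 is odd. -/
theorem conjAut_commute_iff {g d : Matrix (Fin 5) (Fin 5) ℂ} (hg : gᵀ * g = 1) (hd : dᵀ * d = 1) :
    (∀ x, conjAut e g hg (conjAut e d hd x) = conjAut e d hd (conjAut e g hg x)) ↔
      g * d = d * g := by
  constructor
  swap
  · intro h x
    apply toMat_injective e
    simp only [toMat_conjAut]
    calc _ = (g * d) * toMat e x * (g * d)ᵀ := by simp only [transpose_mul, mul_assoc]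
      _ = _ := by rw [h]; simp only [transpose_mul, mul_assoc]
  intro h
  have hgd : (g * d)ᵀ * (g * d) = 1 := by
    calc _ = dᵀ * (gᵀ * g) * d := by simp only [transpose_mul, mul_assoc]
      _ = 1 := by rw [hg, mul_one, hd]
  have hdg : (d * g)ᵀ * (d * g) = 1 := by
    calc _ = gᵀ * (dᵀ * d) * g := by simp only [transpose_mul, mul_assoc]
      _ = 1 := by rw [hd, mul_one, hg]
  obtain ⟨c, hc⟩ := exists_eq_smul_one_of_commute (N := (d * g)ᵀ * (g * d)) fun Z hZ => by
    have h1 := congrArg (toMat e) (h (ofMat e Z hZ))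
    simp only [toMat_conjAut, toMat_ofMat] at h1
    have h2 : (g * d) * Z * (g * d)ᵀ = (d * g) * Z * (d * g)ᵀ := by
      simpa only [transpose_mul, mul_assoc] using h1
    calc _ = (d * g)ᵀ * ((g * d) * Z * ((g * d)ᵀ * (g * d))) := by
          rw [hgd]; simp only [mul_assoc, mul_one]
      _ = (d * g)ᵀ * ((g * d) * Z * (g * d)ᵀ) * (g * d) := by simp only [mul_assoc]
      _ = ((d * g)ᵀ * (d * g)) * Z * ((d * g)ᵀ * (g * d)) := by rw [h2]; simp only [mul_assoc]
      _ = _ := by rw [hdg, one_mul]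
  have h3 : g * d = c • (d * g) := by
    calc g * d = ((d * g) * (d * g)ᵀ) * (g * d) := by rw [mul_eq_one_comm.mp hdg, one_mul]
      _ = (d * g) * ((d * g)ᵀ * (g * d)) := by simp only [mul_assoc]
      _ = _ := by rw [hc, mul_smul_comm, mul_one]
  have hc2 : c ^ 2 = 1 := by
    have h4 := hgd
    rw [h3, transpose_smul, smul_mul_smul_comm, hdg] at h4
    have := congrFun (congrFun h4 0) 0
    simpa [sq] using this
  have hdet : (d * g).det ≠ 0 := fun h0 => by
    have := congrArg det hdg
    rw [det_mul, h0, mul_zero, det_one] at this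
    exact zero_ne_one this
  have hc5 : c ^ 5 = 1 := by
    have h4 := congrArg det h3
    rw [det_smul, Fintype.card_fin, det_mul_comm] at h4
    exact mul_right_cancel₀ hdet (by rw [one_mul]; exact h4.symm)
  have : c = 1 := by linear_combination hc5 - (c ^ 3 + c) * hc2
  rw [h3, this, one_smul]

/-- The automorphisms of `L` diagonal with respect to an adapted basis. -/
def adaptedGroup (b : Fin 5 → Fin 5 → ℂ) : Set (L ≃ₗ⁅ℂ⁆ L) :=
  {φ | ∃ g, ∃ hg : gᵀ * g = 1, φ = conjAut e g hg ∧ ∀ i, ∃ c : ℂ, g *ᵥ b i = c • b i}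

variable {b b' : Fin 5 → Fin 5 → ℂ} {k : Fin 3}

theorem exists_diagonal (hb : IsAdaptedBasis k b) (m : Fin 5) :
    ∃ g, ∃ hg : gᵀ * g = 1, conjAut e g hg ∈ adaptedGroup e b ∧
      ∀ i, g *ᵥ b i = ZMod.stdAddChar (weight k i m) • b i := by
  obtain ⟨g, hg, h⟩ := hb.exists_orthogonal (hb.smul
    (c := fun i => ZMod.stdAddChar (weight k i m)) fun i => by
      rw [← AddChar.map_add_eq_mul, ← Pi.add_apply, weight_add_weight_pairing, Pi.zero_apply,
        AddChar.map_zero_eq_one])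
  exact ⟨g, hg, ⟨g, hg, rfl, fun i => ⟨_, h i⟩⟩, h⟩

theorem conjAut_wedge_of_diagonal {g : Matrix (Fin 5) (Fin 5) ℂ} (hg : gᵀ * g = 1) {c : Fin 5 → ℂ}
    (h : ∀ i, g *ᵥ b i = c i • b i) (i j : Fin 5) :
    conjAut e g hg (wedge e (b i) (b j)) = (c i * c j) • wedge e (b i) (b j) := by
  rw [conjAut_wedge, h, h, map_smul, map_smul, LinearMap.smul_apply, smul_smul, mul_comm]

theorem adaptedGroup_scalar (hb : IsAdaptedBasis k b) {φ : L ≃ₗ⁅ℂ⁆ L} (hφ : φ ∈ adaptedGroup e b)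
    (p : IncPair) : ∃ α : ℂ, ∀ x ∈ weightSpace e hb (pairWeight k p), φ x = α • x := by
  obtain ⟨g, hg, rfl, hc⟩ := hφ
  choose c hc using hc
  refine ⟨c p.1.1 * c p.1.2, fun x hx => ?_⟩
  induction hx using Submodule.span_induction with
  | mem x hx =>
    obtain ⟨q, hq, rfl⟩ := hx
    rw [wedgeBasis_apply, conjAut_wedge_of_diagonal e hg hc]
    congr 1
    rcases eq_or_of_weight_add_eq k _ _ q.2 _ _ p.2 hq with ⟨h1, h2⟩ | ⟨h1, h2⟩
    · rw [h1, h2]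
    -- Both bivectors come from hyperbolic pairs, on each of which the two eigenvalues multiply to
    -- 1.
    · rw [h1, h2, hb.mul_eq_one_of_mulVec_eq hg hc, hb.mul_eq_one_of_mulVec_eq hg hc]
  | zero => simp
  | add x y _ _ hx hy => rw [map_add, hx, hy, smul_add]
  | smul a x _ hx => rw [map_smul, hx, smul_comm]

theorem adaptedGroup_subset_diag (hb : IsAdaptedBasis k b) :
    adaptedGroup e b ⊆ (adaptedGrading e hb).Diag := by
  rintro φ hφ ⟨w, p, rfl⟩
  exact adaptedGroup_scalar e hb hφ p

theorem conjAut_apply_of_mem_weightSpace (hb : IsAdaptedBasis k b)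
    {g : Matrix (Fin 5) (Fin 5) ℂ} (hg : gᵀ * g = 1) {m : Fin 5}
    (h : ∀ i, g *ᵥ b i = ZMod.stdAddChar (weight k i m) • b i) {w : Fin 5 → ZMod 4} {x : L}
    (hx : x ∈ weightSpace e hb w) : conjAut e g hg x = ZMod.stdAddChar (w m) • x := by
  induction hx using Submodule.span_induction with
  | mem x hx =>
    obtain ⟨q, rfl, rfl⟩ := hx
    rw [wedgeBasis_apply, conjAut_wedge_of_diagonal e hg h, ← AddChar.map_add_eq_mul]
    rfl
  | zero => simp
  | add x y _ _ hx hy => rw [map_add, hx, hy, smul_add]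
  | smul a x _ hx => rw [map_smul, hx, smul_comm]

theorem isSeparatedBy_adaptedGroup (hb : IsAdaptedBasis k b) :
    (adaptedGrading e hb).IsSeparatedBy (adaptedGroup e b) := by
  intro w w' hne
  obtain ⟨m, hm⟩ := Function.ne_iff.mp fun h => hne (Subtype.ext h)
  obtain ⟨g, hg, hmem, h⟩ := exists_diagonal e hb m
  exact ⟨_, hmem, _, _, ZMod.injective_stdAddChar.ne hm,
    fun x hx => conjAut_apply_of_mem_weightSpace e hb hg h hx,
    fun x hx => conjAut_apply_of_mem_weightSpace e hb hg h hx⟩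

theorem weight_ne : ∀ k i j, j ≠ i → weight k j i ≠ weight k i i := by decide

theorem IsAdaptedBasis.dotProduct_sum (hb : IsAdaptedBasis k b) (a : Fin 5 → ℂ) (l : Fin 5) :
    b (pairing k l) ⬝ᵥ ∑ i, a i • b i = a l := by
  rw [_root_.dotProduct_sum]
  simp [dotProduct_smul, hb _ _, pairing_pairing]

theorem isMADGroup_adaptedGroup (hb : IsAdaptedBasis k b) : IsMADGroup (adaptedGroup e b) where
  diagonalizable φ hφ :=
    (adaptedGrading e hb).isDiagonalizableAut_of_mem_diag (adaptedGroup_subset_diag e hb hφ)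
  commute φ hφ ψ hψ := (adaptedGrading e hb).commute_of_mem_diag
    (adaptedGroup_subset_diag e hb hφ) (adaptedGroup_subset_diag e hb hψ)
  maximal φ _ hφ := by
    obtain ⟨g, hg, rfl⟩ := exists_eq_conjAut e φ
    refine ⟨g, hg, rfl, fun i => ?_⟩
    -- The eigenvalue of this $d$ on $b_i$ is attained at no other basis vector, so any $g$
    -- commuting with $d$ preserves the line of $b_i$.
    obtain ⟨d, hd, hmem, h⟩ := exists_diagonal e hb i
    have hgd := (conjAut_commute_iff e hg hd).mp (hφ _ hmem)
    set a : Fin 5 → ℂ := fun j => b (pairing k j) ⬝ᵥ g *ᵥ b i with ha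
    have h1 : g *ᵥ b i = ∑ j, a j • b j := hb.eq_sum _
    have h2 : d *ᵥ g *ᵥ b i = ZMod.stdAddChar (weight k i i) • g *ᵥ b i := by
      rw [mulVec_mulVec, ← hgd, ← mulVec_mulVec, h, mulVec_smul]
    have h3 : d *ᵥ g *ᵥ b i = ∑ j, (a j * ZMod.stdAddChar (weight k j i)) • b j := by
      rw [h1, mulVec_sum]
      exact Finset.sum_congr rfl fun j _ => by rw [mulVec_smul, h, smul_smul]
    refine ⟨a i, h1.trans (Finset.sum_eq_single i (fun j _ hj => ?_) (by simp))⟩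
    have h4 : a j * ZMod.stdAddChar (weight k j i) = ZMod.stdAddChar (weight k i i) * a j := by
      rw [← hb.dotProduct_sum (fun j => a j * ZMod.stdAddChar (weight k j i)) j, ← h3, h2,
        dotProduct_smul, smul_eq_mul]
    have h5 : (ZMod.stdAddChar (weight k j i) - ZMod.stdAddChar (weight k i i) : ℂ) * a j = 0 := by
      linear_combination h4
    rw [(mul_eq_zero.mp h5).resolve_left
      (sub_ne_zero.mpr (ZMod.injective_stdAddChar.ne (weight_ne k i j hj))), zero_smul]

theorem isEquivalent_adaptedGrading (hb : IsAdaptedBasis k b) (hb' : IsAdaptedBasis k b') :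
    (adaptedGrading e hb).IsEquivalent (adaptedGrading e hb') := by
  obtain ⟨g, hg, h⟩ := hb.exists_orthogonal hb'
  refine ⟨conjAut e g hg, Equiv.refl _, fun w => ?_⟩
  change (weightSpace e hb w.1).map _ = weightSpace e hb' w.1
  rw [weightSpace, weightSpace, Submodule.map_span, ← Set.image_comp]
  congr 1
  refine Set.image_congr fun p _ => ?_
  change conjAut e g hg (wedgeBasis e hb p) = _
  rw [wedgeBasis_apply, wedgeBasis_apply, conjAut_wedge, h, h]

theorem diag_adaptedGrading (hb : IsAdaptedBasis k b) :
    (adaptedGrading e hb).Diag = adaptedGroup e b :=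
  (adaptedGrading e hb).diag_eq_of_isMADGroup (adaptedGroup_subset_diag e hb)
    (isMADGroup_adaptedGroup e hb)

theorem areConjugate_adaptedGroup (hb : IsAdaptedBasis k b) (hb' : IsAdaptedBasis k b') :
    AreConjugate (adaptedGroup e b) (adaptedGroup e b') := by
  rw [← diag_adaptedGrading e hb, ← diag_adaptedGrading e hb']
  exact (isEquivalent_adaptedGrading e hb hb').areConjugate_diag

/-- The subspace of elements fixed by a set of automorphisms. -/
def fixedSpace (G : Set (L ≃ₗ⁅ℂ⁆ L)) : Submodule ℂ L where
  carrier := {x | ∀ φ ∈ G, φ x = x}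
  add_mem' hx hy φ hφ := by rw [map_add, hx φ hφ, hy φ hφ]
  zero_mem' φ _ := map_zero φ
  smul_mem' c x hx φ hφ := by rw [map_smul, hx φ hφ]

theorem finrank_fixedSpace_eq {G G' : Set (L ≃ₗ⁅ℂ⁆ L)} (h : AreConjugate G G') :
    Module.finrank ℂ (fixedSpace G) = Module.finrank ℂ (fixedSpace G') := by
  obtain ⟨φ, rfl⟩ := h
  have : fixedSpace ((fun g => (φ.symm.trans g).trans φ) '' G) =
      (fixedSpace G).map (φ.toLinearEquiv : L →ₗ[ℂ] L) := by
    ext x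
    constructor
    · intro hx
      refine ⟨φ.symm x, fun ψ hψ => ?_, φ.apply_symm_apply x⟩
      have : φ (ψ (φ.symm x)) = x := hx _ ⟨ψ, hψ, rfl⟩
      conv_rhs => rw [← this]
      rw [φ.symm_apply_apply]
    · rintro ⟨y, hy, rfl⟩ _ ⟨ψ, hψ, rfl⟩
      change φ (ψ (φ.symm (φ y))) = φ y
      rw [φ.symm_apply_apply, hy ψ hψ]
  rw [this, LinearEquiv.finrank_map_eq]

/-- Its dimension is the number of hyperbolic pairs, that is 2, 1, 0 for the three types, and is
invariant under conjugacy. -/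
theorem fixedSpace_adaptedGroup (hb : IsAdaptedBasis k b) :
    fixedSpace (adaptedGroup e b) = weightSpace e hb 0 := by
  apply le_antisymm
  · intro x hx
    rw [mem_weightSpace_iff]
    intro p hp
    obtain ⟨m, hm⟩ := Function.ne_iff.mp hp
    obtain ⟨g, hg, hmem, h⟩ := exists_diagonal e hb m
    have h1 : ((wedgeBasis e hb).repr.toLinearMap ∘ₗ (conjAut e g hg : L →ₗ[ℂ] L)) x p =
        ZMod.stdAddChar (pairWeight k p m) * (wedgeBasis e hb).repr x p := by
      let f₁ : L →ₗ[ℂ] ℂ := Finsupp.lapply p ∘ₗ (wedgeBasis e hb).repr.toLinearMap ∘ₗ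
        (conjAut e g hg : L →ₗ[ℂ] L)
      let f₂ : L →ₗ[ℂ] ℂ := (ZMod.stdAddChar (pairWeight k p m) : ℂ) • (Finsupp.lapply p ∘ₗ
        (wedgeBasis e hb).repr.toLinearMap)
      have : f₁ = f₂ := (wedgeBasis e hb).ext fun q => by
        have h2 : conjAut e g hg (wedgeBasis e hb q) =
            ZMod.stdAddChar (pairWeight k q m) • wedgeBasis e hb q :=
          conjAut_apply_of_mem_weightSpace e hb hg h (Submodule.subset_span ⟨q, rfl, rfl⟩)
        change (wedgeBasis e hb).repr (conjAut e g hg (wedgeBasis e hb q)) p =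
          ZMod.stdAddChar (pairWeight k p m) * (wedgeBasis e hb).repr (wedgeBasis e hb q) p
        rw [h2, map_smul, Module.Basis.repr_self, Finsupp.smul_apply, smul_eq_mul,
          Finsupp.single_apply]
        split_ifs with hqp
        · rw [hqp]
        · simp
      exact LinearMap.congr_fun this x
    have h2 : (wedgeBasis e hb).repr x p =
        ZMod.stdAddChar (pairWeight k p m) * (wedgeBasis e hb).repr x p := by
      rw [← h1]
      change _ = (wedgeBasis e hb).repr (conjAut e g hg x) p
      rw [hx _ hmem]
    have h3 : (ZMod.stdAddChar (pairWeight k p m) - ZMod.stdAddChar (0 : ZMod 4) : ℂ) *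
        (wedgeBasis e hb).repr x p = 0 := by
      rw [AddChar.map_zero_eq_one]; linear_combination -h2
    exact (mul_eq_zero.mp h3).resolve_left
      (sub_ne_zero.mpr (ZMod.injective_stdAddChar.ne hm))
  · rw [weightSpace, Submodule.span_le]
    rintro _ ⟨p, hp, rfl⟩ _ ⟨g, hg, rfl, hc⟩
    choose c hc using hc
    rw [wedgeBasis_apply, conjAut_wedge_of_diagonal e hg hc,
      eq_pairing_of_weight_add_eq_zero k _ _ p.2.ne hp, hb.mul_eq_one_of_mulVec_eq hg hc, one_smul]

theorem card_pairWeight_eq_zero : ∀ k k', Fintype.card {p // pairWeight k p = 0} =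
    Fintype.card {p // pairWeight k' p = 0} → k = k' := by decide

/-- Adapted bases of different types have non-conjugate groups. -/
theorem eq_of_areConjugate_adaptedGroup {k' : Fin 3} (hb : IsAdaptedBasis k b)
    (hb' : IsAdaptedBasis k' b') (h : AreConjugate (adaptedGroup e b) (adaptedGroup e b')) :
    k = k' := by
  have := finrank_fixedSpace_eq h
  rw [fixedSpace_adaptedGroup e hb, fixedSpace_adaptedGroup e hb', finrank_weightSpace,
    finrank_weightSpace] at this
  exact card_pairWeight_eq_zero k k' this

end

end

/-! ### Simultaneous diagonalization in an adapted basis. -/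

section

open Matrix

/-- A partial orthonormal-hyperbolic basis with vectors in a set `S` and a subspace `W`. -/
structure IsHyperbolicFamily (S : Set (Fin 5 → ℂ)) (W : Submodule ℂ (Fin 5 → ℂ)) (p q : ℕ)
    (a : Fin p → Fin 5 → ℂ) (u w : Fin q → Fin 5 → ℂ) : Prop where
  a_mem : ∀ i, a i ∈ S ∩ W
  u_mem : ∀ i, u i ∈ S ∩ W
  w_mem : ∀ i, w i ∈ S ∩ W
  aa : ∀ i j, a i ⬝ᵥ a j = if i = j then 1 else 0
  au : ∀ i j, a i ⬝ᵥ u j = 0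
  aw : ∀ i j, a i ⬝ᵥ w j = 0
  uu : ∀ i j, u i ⬝ᵥ u j = 0
  ww : ∀ i j, w i ⬝ᵥ w j = 0
  uw : ∀ i j, u i ⬝ᵥ w j = if i = j then 1 else 0
  le_span : W ≤ Submodule.span ℂ (Set.range a ∪ Set.range u ∪ Set.range w)

/-- Here $\pi$ acts as the orthogonal projection of $W$ onto $W'$; it carries the induction
hypotheses of the Gram–Schmidt process from $W$ to $W'$. -/
theorem span_and_nondegenerate_of_projection {S : Set (Fin 5 → ℂ)}
    {W W' : Submodule ℂ (Fin 5 → ℂ)} (π : (Fin 5 → ℂ) →ₗ[ℂ] (Fin 5 → ℂ))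
    (hW : W ≤ Submodule.span ℂ (S ∩ W)) (hnd : ∀ x ∈ W, (∀ y ∈ W, x ⬝ᵥ y = 0) → x = 0)
    (hle : W' ≤ W) (hS : ∀ s ∈ S ∩ W, π s ∈ S ∩ W') (hid : ∀ x ∈ W', π x = x)
    (horth : ∀ x ∈ W', ∀ y ∈ W, x ⬝ᵥ π y = x ⬝ᵥ y) :
    W' ≤ Submodule.span ℂ (S ∩ W') ∧ ∀ x ∈ W', (∀ y ∈ W', x ⬝ᵥ y = 0) → x = 0 := by
  have hπ : ∀ y ∈ W, π y ∈ Submodule.span ℂ (S ∩ W') := fun y hy => by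
    have h1 : Submodule.span ℂ (S ∩ W) ≤ (Submodule.span ℂ (S ∩ W')).comap π :=
      Submodule.span_le.mpr fun s hs => Submodule.subset_span (hS s hs)
    exact h1 (hW hy)
  refine ⟨fun x hx => hid x hx ▸ hπ x (hle hx), fun x hx h => hnd x (hle hx) fun y hy => ?_⟩
  rw [← horth x hx y hy]
  have h2 : Submodule.span ℂ (S ∩ W') ≤ W' := Submodule.span_le.mpr Set.inter_subset_right
  exact h _ (h2 (hπ y hy))

/-- In the application $S$ consists of common eigenvectors, and `hadd` expresses that two
eigenvectors not orthogonal to a third have the same eigenvalues. By induction on the dimension, one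
splits off a non-isotropic vector of $S$ if there is one, and a hyperbolic pair otherwise. -/
theorem exists_isHyperbolicFamily {S : Set (Fin 5 → ℂ)} (hsmul : ∀ c : ℂ, ∀ s ∈ S, c • s ∈ S)
    (hadd : ∀ s ∈ S, ∀ b ∈ S, ∀ b' ∈ S, s ⬝ᵥ b' ≠ 0 → b ⬝ᵥ b' ≠ 0 → ∀ c : ℂ, s + c • b ∈ S)
    (W : Submodule ℂ (Fin 5 → ℂ)) (hW : W ≤ Submodule.span ℂ (S ∩ W))
    (hnd : ∀ x ∈ W, (∀ y ∈ W, x ⬝ᵥ y = 0) → x = 0) :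
    ∃ p q a u w, IsHyperbolicFamily S W p q a u w := by
  induction hn : Module.finrank ℂ W using Nat.strong_induction_on generalizing W with
  | _ n ih =>
  have hadd' {s b b' : Fin 5 → ℂ} (hs : s ∈ S) (hb : b ∈ S) (hb' : b' ∈ S) (hbb : b ⬝ᵥ b' ≠ 0) :
      s + (-(s ⬝ᵥ b')) • b ∈ S := by
    by_cases h : s ⬝ᵥ b' = 0
    · rw [h, neg_zero, zero_smul, add_zero]; exact hs
    · exact hadd s hs b hb b' hb' h hbb _
  by_cases hbot : W = ⊥
  · refine ⟨0, 0, Fin.elim0, Fin.elim0, Fin.elim0, ?_⟩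
    constructor <;> first | exact fun i => i.elim0 | (rw [hbot]; exact bot_le)
  by_cases hA : ∃ s ∈ S ∩ W, s ⬝ᵥ s ≠ 0
  · obtain ⟨t, ht, htt⟩ := hA
    obtain ⟨r, hr⟩ := IsAlgClosed.exists_pow_nat_eq (t ⬝ᵥ t) (n := 2) (by norm_num)
    have hr0 : r ≠ 0 := by rintro rfl; exact htt (by simpa using hr.symm)
    obtain ⟨s, hs, hss⟩ : ∃ s ∈ S ∩ W, s ⬝ᵥ s = 1 := by
      refine ⟨r⁻¹ • t, ⟨hsmul _ _ ht.1, W.smul_mem _ ht.2⟩, ?_⟩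
      rw [smul_dotProduct, dotProduct_smul, ← hr, smul_eq_mul, smul_eq_mul]
      field_simp
    let W' : Submodule ℂ (Fin 5 → ℂ) := W ⊓ LinearMap.ker (dotProductBilin ℂ ℂ s)
    have hmem {x} : x ∈ W' ↔ x ∈ W ∧ s ⬝ᵥ x = 0 := Iff.rfl
    let π : (Fin 5 → ℂ) →ₗ[ℂ] (Fin 5 → ℂ) :=
      LinearMap.id - (dotProductBilin ℂ ℂ s).smulRight s
    have hπ (x) : π x = x - (s ⬝ᵥ x) • s := rfl
    obtain ⟨h1, h2⟩ := span_and_nondegenerate_of_projection (W' := W') π hW hnd inf_le_left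
      (fun y hy => by
        rw [hπ]
        refine ⟨?_, hmem.mpr ⟨W.sub_mem hy.2 (W.smul_mem _ hs.2), ?_⟩⟩
        · rw [sub_eq_add_neg, ← neg_smul, dotProduct_comm]
          exact hadd' hy.1 hs.1 hs.1 (by rw [hss]; exact one_ne_zero)
        · rw [dotProduct_sub, dotProduct_smul, hss]; simp)
      (fun x hx => by rw [hπ, (hmem.mp hx).2, zero_smul, sub_zero])
      (fun x hx y _ => by
        rw [hπ, dotProduct_sub, dotProduct_smul, dotProduct_comm x s, (hmem.mp hx).2]; simp)
    have hlt : W' < W := lt_of_le_of_ne inf_le_left fun h => by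
      have := (hmem.mp (h.symm ▸ hs.2 : s ∈ W')).2
      rw [hss] at this; exact one_ne_zero this
    obtain ⟨p, q, a, u, w, hF⟩ := ih _ (hn ▸ Submodule.finrank_lt_finrank_of_lt hlt) W' h1 h2 rfl
    have hinc {x} (hx : x ∈ S ∩ W') : x ∈ S ∩ W := ⟨hx.1, (hmem.mp hx.2).1⟩
    refine ⟨p + 1, q, Fin.cons s a, u, w, ?_⟩
    constructor
    · exact Fin.cases hs fun i => hinc (hF.a_mem i)
    · exact fun i => hinc (hF.u_mem i)
    · exact fun i => hinc (hF.w_mem i)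
    · refine Fin.cases (Fin.cases (by simpa using hss) fun j => ?_)
        fun i => Fin.cases ?_ fun j => ?_
      · simpa [(Fin.succ_ne_zero j).symm] using (hmem.mp (hF.a_mem j).2).2
      · simpa [dotProduct_comm] using (hmem.mp (hF.a_mem i).2).2
      · simpa using hF.aa i j
    · exact Fin.cases (fun j => (hmem.mp (hF.u_mem j).2).2) fun i j => hF.au i j
    · exact Fin.cases (fun j => (hmem.mp (hF.w_mem j).2).2) fun i j => hF.aw i j
    · exact hF.uu
    · exact hF.ww
    · exact hF.uw
    · intro x hx
      have hx' : x - (s ⬝ᵥ x) • s ∈ W' := hmem.mpr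
        ⟨W.sub_mem hx (W.smul_mem _ hs.2), by rw [dotProduct_sub, dotProduct_smul, hss]; simp⟩
      rw [← sub_add_cancel x ((s ⬝ᵥ x) • s)]
      refine add_mem (Submodule.span_mono ?_ (hF.le_span hx')) (Submodule.smul_mem _ _
        (Submodule.subset_span (Or.inl (Or.inl ⟨0, rfl⟩))))
      rw [Fin.range_cons]
      exact Set.union_subset_union_left _ (Set.union_subset_union_left _ (Set.subset_insert _ _))
  · push Not at hA
    obtain ⟨s, hs, hs0⟩ : ∃ s ∈ S ∩ W, s ≠ 0 := by
      by_contra! h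
      refine hbot (le_bot_iff.mp (hW.trans (Submodule.span_le.mpr fun s hs => ?_)))
      exact (Submodule.mem_bot ℂ).mpr (h s hs)
    obtain ⟨t', ht', hst'⟩ : ∃ t ∈ S ∩ W, s ⬝ᵥ t ≠ 0 := by
      by_contra! h
      refine hs0 (hnd s hs.2 fun y hy => ?_)
      have h1 : Submodule.span ℂ (S ∩ W) ≤ LinearMap.ker (dotProductBilin ℂ ℂ s) :=
        Submodule.span_le.mpr fun t ht => h t ht
      exact h1 (hW hy)
    obtain ⟨t, ht, hst⟩ : ∃ t ∈ S ∩ W, s ⬝ᵥ t = 1 := by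
      refine ⟨(s ⬝ᵥ t')⁻¹ • t', ⟨hsmul _ _ ht'.1, W.smul_mem _ ht'.2⟩, ?_⟩
      rw [dotProduct_smul, smul_eq_mul, inv_mul_cancel₀ hst']
    have hss := hA s hs
    have htt := hA t ht
    have hts : t ⬝ᵥ s = 1 := by rw [dotProduct_comm, hst]
    let W' : Submodule ℂ (Fin 5 → ℂ) :=
      W ⊓ (LinearMap.ker (dotProductBilin ℂ ℂ s) ⊓ LinearMap.ker (dotProductBilin ℂ ℂ t))
    have hmem {x} : x ∈ W' ↔ x ∈ W ∧ s ⬝ᵥ x = 0 ∧ t ⬝ᵥ x = 0 := Iff.rfl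
    let π : (Fin 5 → ℂ) →ₗ[ℂ] (Fin 5 → ℂ) :=
      LinearMap.id - (dotProductBilin ℂ ℂ t).smulRight s - (dotProductBilin ℂ ℂ s).smulRight t
    have hπ (x) : π x = x - (t ⬝ᵥ x) • s - (s ⬝ᵥ x) • t := rfl
    have hπW {x} (hx : x ∈ W) : x - (t ⬝ᵥ x) • s - (s ⬝ᵥ x) • t ∈ W' := hmem.mpr
      ⟨W.sub_mem (W.sub_mem hx (W.smul_mem _ hs.2)) (W.smul_mem _ ht.2), by
        simp [dotProduct_sub, hss, hst], by simp [dotProduct_sub, htt, hts]⟩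
    obtain ⟨h1, h2⟩ := span_and_nondegenerate_of_projection (W' := W') π hW hnd inf_le_left
      (fun y hy => by
        rw [hπ]
        refine ⟨?_, hπW hy.2⟩
        -- The two components are removed one after the other. Since $s$ is isotropic, the first
        -- removal does not change the second coefficient.
        have h3 := hadd' hy.1 hs.1 ht.1 (by rw [hst]; exact one_ne_zero)
        have h4 := hadd' h3 ht.1 hs.1 (by rw [hts]; exact one_ne_zero)
        rw [add_dotProduct, smul_dotProduct, hss, smul_zero, add_zero] at h4
        rw [sub_eq_add_neg, sub_eq_add_neg, ← neg_smul, ← neg_smul, dotProduct_comm t,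
          dotProduct_comm s]
        exact h4)
      (fun x hx => by
        rw [hπ, (hmem.mp hx).2.1, (hmem.mp hx).2.2, zero_smul, zero_smul, sub_zero, sub_zero])
      (fun x hx y _ => by
        rw [hπ, dotProduct_sub, dotProduct_sub, dotProduct_smul, dotProduct_smul,
          dotProduct_comm x s, dotProduct_comm x t, (hmem.mp hx).2.1, (hmem.mp hx).2.2]; simp)
    have hlt : W' < W := lt_of_le_of_ne inf_le_left fun h => by
      have := (hmem.mp (h.symm ▸ ht.2 : t ∈ W')).2.1
      rw [hst] at this; exact one_ne_zero this
    obtain ⟨p, q, a, u, w, hF⟩ := ih _ (hn ▸ Submodule.finrank_lt_finrank_of_lt hlt) W' h1 h2 rfl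
    have hinc {x} (hx : x ∈ S ∩ W') : x ∈ S ∩ W := ⟨hx.1, (hmem.mp hx.2).1⟩
    have hso {x} (hx : x ∈ S ∩ W') : s ⬝ᵥ x = 0 ∧ x ⬝ᵥ s = 0 :=
      ⟨(hmem.mp hx.2).2.1, by rw [dotProduct_comm]; exact (hmem.mp hx.2).2.1⟩
    have hto {x} (hx : x ∈ S ∩ W') : t ⬝ᵥ x = 0 ∧ x ⬝ᵥ t = 0 :=
      ⟨(hmem.mp hx.2).2.2, by rw [dotProduct_comm]; exact (hmem.mp hx.2).2.2⟩
    refine ⟨p, q + 1, a, Fin.cons s u, Fin.cons t w, ?_⟩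
    constructor
    · exact fun i => hinc (hF.a_mem i)
    · exact Fin.cases hs fun i => hinc (hF.u_mem i)
    · exact Fin.cases ht fun i => hinc (hF.w_mem i)
    · exact hF.aa
    · exact fun i => Fin.cases (hso (hF.a_mem i)).2 fun j => hF.au i j
    · exact fun i => Fin.cases (hto (hF.a_mem i)).2 fun j => hF.aw i j
    · exact Fin.cases (Fin.cases hss fun j => (hso (hF.u_mem j)).1)
        fun i => Fin.cases (hso (hF.u_mem i)).2 fun j => hF.uu i j
    · exact Fin.cases (Fin.cases htt fun j => (hto (hF.w_mem j)).1)
        fun i => Fin.cases (hto (hF.w_mem i)).2 fun j => hF.ww i j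
    · refine Fin.cases (Fin.cases (by simpa using hst) fun j => ?_)
        fun i => Fin.cases ?_ fun j => ?_
      · simpa [(Fin.succ_ne_zero j).symm] using (hso (hF.w_mem j)).1
      · simpa using (hto (hF.u_mem i)).2
      · simpa using hF.uw i j
    · intro x hx
      have hx' := hπW hx
      have : x = (x - (t ⬝ᵥ x) • s - (s ⬝ᵥ x) • t) + (t ⬝ᵥ x) • s + (s ⬝ᵥ x) • t := by abel
      rw [this]
      refine add_mem (add_mem (Submodule.span_mono ?_ (hF.le_span hx')) (Submodule.smul_mem _ _
        (Submodule.subset_span (Or.inl (Or.inr ⟨0, rfl⟩))))) (Submodule.smul_mem _ _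
        (Submodule.subset_span (Or.inr ⟨0, rfl⟩)))
      rw [Fin.range_cons, Fin.range_cons]
      exact Set.union_subset_union (Set.union_subset_union_right _ (Set.subset_insert _ _))
        (Set.subset_insert _ _)

theorem IsHyperbolicFamily.add_two_mul {S : Set (Fin 5 → ℂ)} {p q : ℕ} {a : Fin p → Fin 5 → ℂ}
    {u w : Fin q → Fin 5 → ℂ} (h : IsHyperbolicFamily S ⊤ p q a u w) : p + 2 * q = 5 := by
  let f : Fin p ⊕ Fin q ⊕ Fin q → Fin 5 → ℂ := Sum.elim a (Sum.elim u w)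
  have hli : LinearIndependent ℂ f := by
    rw [Fintype.linearIndependent_iff]
    intro c hc
    simp only [Fintype.sum_sum_type, f, Sum.elim_inl, Sum.elim_inr] at hc
    have hd (x : Fin 5 → ℂ) := congrArg (x ⬝ᵥ ·) hc
    simp only [dotProduct_add, dotProduct_sum, dotProduct_smul, dotProduct_zero] at hd
    have hua (i j) : u i ⬝ᵥ a j = 0 := by rw [dotProduct_comm, h.au]
    have hwa (i j) : w i ⬝ᵥ a j = 0 := by rw [dotProduct_comm, h.aw]
    have hwu (i j) : w i ⬝ᵥ u j = if j = i then 1 else 0 := by rw [dotProduct_comm, h.uw]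
    rintro (i | i | i)
    · simpa [h.aa, h.au, h.aw] using hd (a i)
    · simpa [hwa, hwu, h.ww] using hd (w i)
    · simpa [hua, h.uu, h.uw] using hd (u i)
  have hsp : ⊤ ≤ Submodule.span ℂ (Set.range f) := by
    refine h.le_span.trans (Submodule.span_mono ?_)
    simp [f, Set.Sum.elim_range, Set.union_assoc]
  have h1 := Module.finrank_eq_card_basis (Module.Basis.mk hli hsp)
  simp only [Module.finrank_fin_fun, Fintype.card_sum, Fintype.card_fin] at h1
  omega

/-- Since $p+2q=5$, the only possibilities are $q=0,1,2$, which correspond to the pairings of index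
$2,1,0$. -/
theorem IsHyperbolicFamily.exists_isAdaptedBasis {S : Set (Fin 5 → ℂ)} {p q : ℕ}
    {a : Fin p → Fin 5 → ℂ} {u w : Fin q → Fin 5 → ℂ} (h : IsHyperbolicFamily S ⊤ p q a u w) :
    ∃ k b, IsAdaptedBasis k b ∧ ∀ i, b i ∈ S := by
  have h5 := h.add_two_mul
  have hua (i j) : u i ⬝ᵥ a j = 0 := by rw [dotProduct_comm, h.au]
  have hwa (i j) : w i ⬝ᵥ a j = 0 := by rw [dotProduct_comm, h.aw]
  have hwu (i j) : w i ⬝ᵥ u j = if j = i then 1 else 0 := by rw [dotProduct_comm, h.uw]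
  have ha (i) := (h.a_mem i).1
  have hu (i) := (h.u_mem i).1
  have hw (i) := (h.w_mem i).1
  have hq : q = 0 ∨ q = 1 ∨ q = 2 := by omega
  rcases hq with rfl | rfl | rfl
  · obtain rfl : p = 5 := by omega
    refine ⟨2, a, fun i j => ?_, ha⟩
    rw [h.aa]
    fin_cases i <;> fin_cases j <;> simp [pairing]
  · obtain rfl : p = 3 := by omega
    refine ⟨1, ![u 0, w 0, a 0, a 1, a 2], fun i j => ?_, fun i => ?_⟩
    · fin_cases i <;> fin_cases j <;>
        simp [pairing, h.aa, h.au, h.aw, h.uu, h.ww, h.uw, hua, hwa, hwu]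
    · fin_cases i <;> simp [ha, hu, hw]
  · obtain rfl : p = 1 := by omega
    refine ⟨0, ![u 0, w 0, u 1, w 1, a 0], fun i j => ?_, fun i => ?_⟩
    · fin_cases i <;> fin_cases j <;>
        simp [pairing, h.aa, h.au, h.aw, h.uu, h.ww, h.uw, hua, hwa, hwu]
    · fin_cases i <;> simp [ha, hu, hw]

section
variable {L : Type*} [LieRing L] [LieAlgebra ℂ L] (e : L ≃ₗ⁅ℂ⁆ O5)

/-- If conjugation by `g` is diagonalizable, then so is `g`. -/
theorem iSup_eigenspace_eq_top_of_conjAut {g : Matrix (Fin 5) (Fin 5) ℂ} {hg : gᵀ * g = 1}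
    (h : IsDiagonalizableAut (conjAut e g hg)) :
    ⨆ μ : ℂ, Module.End.eigenspace g.mulVecLin μ = ⊤ := by
  -- A $\mu$-eigenvector of the conjugation maps the $\nu$-eigenspace of $g$ into the
  -- $\mu\nu$-eigenspace. So the sum of the eigenspaces is stable under $o(5)$, and irreducibility
  -- applies.
  refine eq_top_of_skew_stable _ (fun Z hZ v hv => ?_) fun hbot => ?_
  · obtain ⟨z, rfl⟩ : ∃ z, Z = toMat e z := ⟨ofMat e Z hZ, by simp⟩
    set U := ⨆ μ : ℂ, Module.End.eigenspace g.mulVecLin μ with hU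
    have hz : z ∈ ⨆ μ : ℂ, Module.End.eigenspace (conjAut e g hg : L →ₗ[ℂ] L) μ := by
      rw [show _ = ⊤ from h]; trivial
    induction hz using Submodule.iSup_induction' with
    | mem μ z hz =>
      have hz' : conjAut e g hg z = μ • z := Module.End.mem_eigenspace_iff.mp hz
      have hgz : g * toMat e z = μ • (toMat e z * g) := by
        have h1 := congrArg (fun x => toMat e x * g) hz'
        simp only [toMat_conjAut, map_smul, smul_mul_assoc] at h1
        rwa [mul_assoc, hg, mul_one] at h1
      induction hv using Submodule.iSup_induction' with
      | mem ν v hv =>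
        refine Submodule.mem_iSup_of_mem (μ * ν) (Module.End.mem_eigenspace_iff.mpr ?_)
        have hv' : g *ᵥ v = ν • v := Module.End.mem_eigenspace_iff.mp hv
        rw [mulVecLin_apply, mulVec_mulVec, hgz, smul_mulVec, ← mulVec_mulVec, hv', mulVec_smul,
          smul_smul]
      | zero => rw [mulVec_zero]; exact zero_mem _
      | add x y _ _ hx hy => rw [mulVec_add]; exact add_mem hx hy
    | zero => rw [map_zero, zero_mulVec]; exact zero_mem _
    | add x y _ _ hx hy =>
      rw [map_add, add_mulVec]
      exact add_mem (hx (toMat_transpose e x)) (hy (toMat_transpose e y))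
  · obtain ⟨μ, hμ⟩ := Module.End.exists_eigenvalue g.mulVecLin
    exact hμ (iSup_eq_bot.mp hbot μ)

theorem maxGenEigenspace_eq_eigenspace {f : Module.End ℂ (Fin 5 → ℂ)}
    (h : ⨆ μ : ℂ, Module.End.eigenspace f μ = ⊤) (μ : ℂ) :
    f.maxGenEigenspace μ = f.eigenspace μ :=
  (iSupIndep.eq_of_le_of_iSup_eq_top (U := fun μ => f.eigenspace μ)
    f.independent_maxGenEigenspace (fun ν => f.genEigenspace_le_maximal ν 1) h μ).symm

/-- A commuting family of diagonalizable automorphisms is diagonal in some adapted basis. -/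
theorem exists_subset_adaptedGroup {G : Set (L ≃ₗ⁅ℂ⁆ L)} (hd : ∀ φ ∈ G, IsDiagonalizableAut φ)
    (hc : ∀ φ ∈ G, ∀ ψ ∈ G, ∀ x, φ (ψ x) = ψ (φ x)) :
    ∃ k b, IsAdaptedBasis k b ∧ G ⊆ adaptedGroup e b := by
  let T : Set (Matrix (Fin 5) (Fin 5) ℂ) := {g | ∃ hg : gᵀ * g = 1, conjAut e g hg ∈ G}
  let S : Set (Fin 5 → ℂ) := {v | ∀ g ∈ T, ∃ c : ℂ, g *ᵥ v = c • v}
  have hmax (g : T) (μ : ℂ) : Module.End.maxGenEigenspace g.1.mulVecLin μ =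
      Module.End.eigenspace g.1.mulVecLin μ := by
    obtain ⟨g, hg, hgG⟩ := g
    exact maxGenEigenspace_eq_eigenspace (iSup_eigenspace_eq_top_of_conjAut e (hd _ hgG)) μ
  have hspan : Submodule.span ℂ S = ⊤ := by
    have h1 := Module.End.iSup_iInf_maxGenEigenspace_eq_top_of_iSup_maxGenEigenspace_eq_top_of_commute
      (fun g : T => g.1.mulVecLin) (fun g g' _ => by
        obtain ⟨g, hg, hgG⟩ := g
        obtain ⟨g', hg', hgG'⟩ := g'
        have := (conjAut_commute_iff e hg hg').mp (hc _ hgG _ hgG')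
        change g.mulVecLin * g'.mulVecLin = g'.mulVecLin * g.mulVecLin
        rw [Module.End.mul_eq_comp, ← mulVecLin_mul, this, mulVecLin_mul]; rfl)
      (fun g => Module.End.iSup_maxGenEigenspace_eq_top _)
    rw [eq_top_iff, ← h1]
    refine iSup_le fun χ v hv => Submodule.subset_span fun g hg => ⟨χ ⟨g, hg⟩, ?_⟩
    simp only [hmax, Submodule.mem_iInf, Module.End.mem_eigenspace_iff] at hv
    exact hv ⟨g, hg⟩
  have hdot {g : Matrix (Fin 5) (Fin 5) ℂ} (hg : gᵀ * g = 1) (x y : Fin 5 → ℂ) :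
      g *ᵥ x ⬝ᵥ g *ᵥ y = x ⬝ᵥ y := by
    rw [dotProduct_mulVec, ← mulVec_transpose, mulVec_mulVec, hg, one_mulVec]
  obtain ⟨p, q, a, u, w, hF⟩ := exists_isHyperbolicFamily (S := S)
    (fun c s hs g hg => by
      obtain ⟨d, hd⟩ := hs g hg
      exact ⟨d, by rw [mulVec_smul, hd, smul_comm]⟩)
    (fun s hs b hb b' hb' hsb hbb c g hg => by
      obtain ⟨χ, hχ⟩ := hs g hg
      obtain ⟨β, hβ⟩ := hb g hg
      obtain ⟨γ, hγ⟩ := hb' g hg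
      have h1 := hdot hg.1 s b'
      have h2 := hdot hg.1 b b'
      rw [hχ, hγ, smul_dotProduct, dotProduct_smul, smul_smul, smul_eq_mul] at h1
      rw [hβ, hγ, smul_dotProduct, dotProduct_smul, smul_smul, smul_eq_mul] at h2
      -- Non-orthogonal eigenvectors of an orthogonal matrix have inverse eigenvalues; both $s$ and
      -- $b$ thus have eigenvalue $\gamma^{-1}$.
      have h3 : χ * γ = 1 := mul_right_cancel₀ hsb (by rw [h1, one_mul])
      have h4 : β * γ = 1 := mul_right_cancel₀ hbb (by rw [h2, one_mul])
      have h5 : γ ≠ 0 := right_ne_zero_of_mul_eq_one h4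
      have h6 : χ = β := mul_right_cancel₀ h5 (h3.trans h4.symm)
      exact ⟨β, by rw [mulVec_add, mulVec_smul, hχ, hβ, h6, smul_add, smul_comm]⟩)
    ⊤ (by rw [Submodule.top_coe, Set.inter_univ, hspan]) fun x _ h => by
      ext i
      simpa using h (Pi.single i 1) trivial
  obtain ⟨k, b, hb, hbS⟩ := hF.exists_isAdaptedBasis
  refine ⟨k, b, hb, fun φ hφ => ?_⟩
  obtain ⟨g, hg, rfl⟩ := exists_eq_conjAut e φ
  exact ⟨g, hg, rfl, fun i => hbS i g ⟨hg, hφ⟩⟩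

/-- Every MAD-group is the diagonal group of an adapted basis. -/
theorem IsMADGroup.exists_eq_adaptedGroup {G : Set (L ≃ₗ⁅ℂ⁆ L)} (hG : IsMADGroup G) :
    ∃ k b, IsAdaptedBasis k b ∧ G = adaptedGroup e b := by
  obtain ⟨k, b, hb, hle⟩ := exists_subset_adaptedGroup e hG.diagonalizable hG.commute
  have hM := isMADGroup_adaptedGroup e hb
  exact ⟨k, b, hb, hle.antisymm fun φ hφ => hG.maximal φ (hM.diagonalizable φ hφ)
    fun ψ hψ => hM.commute φ hφ ψ (hle hψ)⟩

/-- Every fine group grading is given by the weights of an adapted basis. -/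
theorem LieGrading.IsFineGroupGrading.exists_isSame {Δ : LieGrading L}
    (hΔ : Δ.IsFineGroupGrading) :
    ∃ k b, ∃ hb : IsAdaptedBasis k b, (adaptedGrading e hb).IsSame Δ := by
  obtain ⟨k, b, hb, hle⟩ := exists_subset_adaptedGroup e (G := Δ.Diag)
    (fun _ h => Δ.isDiagonalizableAut_of_mem_diag h)
    (fun _ h _ h' x => Δ.commute_of_mem_diag h h' x)
  exact ⟨k, b, hb, hΔ.isSame (isGroupGrading_adaptedGrading e hb)
    (hle.trans (adaptedGroup_subset_diag e hb))⟩

end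

end

/-! ### The Cartan grading. -/

section

open Matrix

section
variable {L : Type*} [LieRing L] [LieAlgebra ℂ L] (e : L ≃ₗ⁅ℂ⁆ O5)
variable {b : Fin 5 → Fin 5 → ℂ}

/-- The subalgebra of elements of weight zero. -/
noncomputable def zeroWeightSubalgebra {k : Fin 3} (hb : IsAdaptedBasis k b) :
    LieSubalgebra ℂ L where
  toSubmodule := weightSpace e hb 0
  lie_mem' hx hy := by
    have := lie_mem_weightSpace e hb hx hy
    rwa [add_zero] at this

theorem mem_zeroWeightSubalgebra {k : Fin 3} (hb : IsAdaptedBasis k b) {x : L} :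
    x ∈ zeroWeightSubalgebra e hb ↔ x ∈ weightSpace e hb 0 := Iff.rfl

/-- The eigenvalues of an element of weight zero on an adapted basis. -/
noncomputable def basisEigenvalue (k : Fin 3) (b : Fin 5 → Fin 5 → ℂ) (i : Fin 5) (h : L) : ℂ :=
  b (pairing k i) ⬝ᵥ toMat e h *ᵥ b i

theorem basisEigenvalue_pairing (k : Fin 3) (i : Fin 5) (h : L) :
    basisEigenvalue e k b (pairing k i) h = -basisEigenvalue e k b i h := by
  rw [basisEigenvalue, basisEigenvalue, pairing_pairing, dotProduct_mulVec, ← mulVec_transpose,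
    toMat_transpose, neg_mulVec, neg_dotProduct, dotProduct_comm]

theorem toMat_mulVec_of_mem_weightSpace_zero {k : Fin 3} (hb : IsAdaptedBasis k b) {h : L}
    (hh : h ∈ weightSpace e hb 0) (i : Fin 5) :
    toMat e h *ᵥ b i = basisEigenvalue e k b i h • b i := by
  have h1 : toMat e h *ᵥ b i ∈ Submodule.span ℂ {b i} := by
    induction hh using Submodule.span_induction with
    | mem x hx =>
      obtain ⟨p, hp, rfl⟩ := hx
      rw [wedgeBasis_apply, eq_pairing_of_weight_add_eq_zero k _ _ p.2.ne hp, toMat_wedge,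
        skewMat_mulVec, hb, hb, pairing_pairing]
      refine sub_mem ?_ ?_
      · split_ifs with h
        · rw [one_smul, h]; exact Submodule.mem_span_singleton_self _
        · rw [zero_smul]; exact zero_mem _
      · split_ifs with h
        · rw [one_smul, h]; exact Submodule.mem_span_singleton_self _
        · rw [zero_smul]; exact zero_mem _
    | zero => rw [map_zero, zero_mulVec]; exact zero_mem _
    | add x y _ _ hx hy => rw [map_add, add_mulVec]; exact add_mem hx hy
    | smul c x _ hx => rw [map_smul, smul_mulVec]; exact Submodule.smul_mem _ _ hx
  obtain ⟨c, hc⟩ := Submodule.mem_span_singleton.mp h1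
  rw [basisEigenvalue, ← hc, dotProduct_smul, hb, pairing_pairing, if_pos rfl, smul_eq_mul, mul_one]

theorem lie_of_mem_weightSpace {k : Fin 3} (hb : IsAdaptedBasis k b) {h : L}
    (hh : h ∈ weightSpace e hb 0) (p : IncPair) {x : L}
    (hx : x ∈ weightSpace e hb (pairWeight k p)) :
    ⁅h, x⁆ = (basisEigenvalue e k b p.1.1 h + basisEigenvalue e k b p.1.2 h) • x := by
  induction hx using Submodule.span_induction with
  | mem x hx =>
    obtain ⟨q, hq, rfl⟩ := hx
    rw [wedgeBasis_apply, lie_wedge, toMat_mulVec_of_mem_weightSpace_zero e hb hh,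
      toMat_mulVec_of_mem_weightSpace_zero e hb hh, map_smul, map_smul, LinearMap.smul_apply,
      ← add_smul]
    congr 1
    rcases eq_or_of_weight_add_eq k _ _ q.2 _ _ p.2 hq with ⟨h1, h2⟩ | ⟨h1, h2⟩
    · rw [h1, h2]
    · rw [h1, h2, basisEigenvalue_pairing, basisEigenvalue_pairing, add_neg_cancel, add_neg_cancel]
  | zero => simp
  | add x y _ _ hx hy => rw [lie_add, hx, hy, smul_add]
  | smul c x _ hx => rw [lie_smul, hx, smul_comm]

/-- The eigenvalues of a regular element. -/
def regularEigenvalue : Fin 5 → ℤ := ![1, -1, 3, -3, 0]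

/-- The values $\pm1,\pm3,0$ are chosen so that the roots take the eight distinct values
$\pm1,\pm2,\pm3,\pm4$. -/
theorem regularEigenvalue_injective : ∀ p q : IncPair,
    regularEigenvalue p.1.1 + regularEigenvalue p.1.2 =
      regularEigenvalue q.1.1 + regularEigenvalue q.1.2 → pairWeight 0 p = pairWeight 0 q := by
  decide

theorem regularEigenvalue_ne_zero : ∀ p : IncPair, pairWeight 0 p ≠ 0 →
    regularEigenvalue p.1.1 + regularEigenvalue p.1.2 ≠ 0 := by decide

theorem exists_regular (hb : IsAdaptedBasis 0 b) :
    ∃ h ∈ weightSpace e hb 0, ∀ i, basisEigenvalue e 0 b i h = regularEigenvalue i := by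
  have hmem (i : Fin 5) : wedge e (b i) (b (pairing 0 i)) ∈ weightSpace e hb 0 := by
    have := wedge_mem_weightSpace e hb i (pairing 0 i)
    rwa [weight_add_weight_pairing] at this
  refine ⟨wedge e (b 0) (b 1) + (3 : ℂ) • wedge e (b 2) (b 3),
    add_mem (hmem 0) (Submodule.smul_mem _ _ (hmem 2)), fun i => ?_⟩
  rw [basisEigenvalue, map_add, map_smul, toMat_wedge, toMat_wedge, add_mulVec, smul_mulVec,
    skewMat_mulVec, skewMat_mulVec]
  simp only [dotProduct_add, dotProduct_smul, dotProduct_sub, hb _ _]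
  fin_cases i <;> simp [pairing, regularEigenvalue]

/-- The subalgebra is abelian. An element normalizing it is bracketed by the regular element into
weight zero, and the regular element has nonzero eigenvalues on all other weights. -/
theorem isCartanSubalgebra_zeroWeightSubalgebra (hb : IsAdaptedBasis 0 b) :
    (zeroWeightSubalgebra e hb).IsCartanSubalgebra := by
  obtain ⟨h, hh, hreg⟩ := exists_regular e hb
  have habel : IsLieAbelian (zeroWeightSubalgebra e hb) := ⟨fun x y => by
    let p : IncPair := ⟨(0, 1), by decide⟩
    have hp : pairWeight 0 p = 0 := by decide
    refine Subtype.ext ((lie_of_mem_weightSpace e hb x.2 p (x := y.1) (hp ▸ y.2)).trans ?_)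
    have h1 := basisEigenvalue_pairing e (b := b) 0 0 x.1
    change basisEigenvalue e 0 b 1 x.1 = _ at h1
    change (basisEigenvalue e 0 b 0 x.1 + basisEigenvalue e 0 b 1 x.1) • _ = _
    rw [h1, add_neg_cancel, zero_smul]
    rfl⟩
  refine ⟨inferInstance, le_antisymm (fun x hx => ?_) (LieSubalgebra.le_normalizer _)⟩
  have h1 : ⁅h, x⁆ ∈ weightSpace e hb 0 := by
    rw [← lie_skew]
    exact neg_mem ((LieSubalgebra.mem_normalizer_iff _ x).mp hx h hh)
  rw [mem_weightSpace_iff] at h1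
  rw [mem_zeroWeightSubalgebra, mem_weightSpace_iff]
  intro p hp
  let f₁ : L →ₗ[ℂ] ℂ := Finsupp.lapply p ∘ₗ (wedgeBasis e hb).repr.toLinearMap ∘ₗ
    LieModule.toEnd ℂ L L h
  let f₂ : L →ₗ[ℂ] ℂ := ((regularEigenvalue p.1.1 + regularEigenvalue p.1.2 : ℤ) : ℂ) •
    (Finsupp.lapply p ∘ₗ (wedgeBasis e hb).repr.toLinearMap)
  have h2 : f₁ = f₂ := (wedgeBasis e hb).ext fun q => by
    change (wedgeBasis e hb).repr ⁅h, wedgeBasis e hb q⁆ p = _ *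
      (wedgeBasis e hb).repr (wedgeBasis e hb q) p
    rw [lie_of_mem_weightSpace e hb hh q (Submodule.subset_span ⟨q, rfl, rfl⟩), hreg, hreg,
      map_smul, Module.Basis.repr_self, Finsupp.smul_apply, smul_eq_mul, Finsupp.single_apply]
    split_ifs with hqp
    · rw [hqp]; push_cast; rfl
    · simp
  have h3 : (wedgeBasis e hb).repr ⁅h, x⁆ p =
      ((regularEigenvalue p.1.1 + regularEigenvalue p.1.2 : ℤ) : ℂ) *
        (wedgeBasis e hb).repr x p := LinearMap.congr_fun h2 x
  rw [h1 p hp] at h3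
  exact (mul_eq_zero.mp h3.symm).resolve_left
    (Int.cast_ne_zero.mpr (regularEigenvalue_ne_zero p hp))

/-- The weight spaces lie in root spaces, with different weights giving different roots. They span
and the root spaces are independent, so the inclusions are equalities and no further root space is
nonzero. -/
theorem isCartanGrading_adaptedGrading (hb : IsAdaptedBasis 0 b) :
    (adaptedGrading e hb).IsCartanGrading := by
  have hH := isCartanSubalgebra_zeroWeightSubalgebra e hb
  set H := zeroWeightSubalgebra e hb with hHdef
  refine ⟨H, hH, ?_⟩
  obtain ⟨h, hh, hreg⟩ := exists_regular e hb
  let χ : {w : Fin 5 → ZMod 4 // ∃ p, pairWeight 0 p = w} → H → ℂ := fun w x =>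
    basisEigenvalue e 0 b w.2.choose.1.1 x.1 + basisEigenvalue e 0 b w.2.choose.1.2 x.1
  have hχ : Function.Injective χ := fun w w' hw => by
    have h1 := congrFun hw ⟨h, hh⟩
    simp only [χ, hreg] at h1
    have h2 := regularEigenvalue_injective w.2.choose w'.2.choose (by exact_mod_cast h1)
    rw [w.2.choose_spec, w'.2.choose_spec] at h2
    exact Subtype.ext h2
  have hle (w) : weightSpace e hb w.1 ≤ (LieAlgebra.rootSpace H (χ w)).toSubmodule := by
    intro x hx
    rw [LieSubmodule.mem_toSubmodule, LieAlgebra.rootSpace, LieModule.mem_genWeightSpace]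
    intro y
    refine ⟨1, ?_⟩
    have := lie_of_mem_weightSpace e hb y.2 w.2.choose (x := x) (by rwa [w.2.choose_spec])
    rw [pow_one]
    change ⁅y.1, x⁆ - χ w y • x = 0
    rw [this, sub_self]
  have hind : iSupIndep fun ψ : H → ℂ => (LieAlgebra.rootSpace H ψ).toSubmodule :=
    LieSubmodule.iSupIndep_toSubmodule.mpr (LieModule.iSupIndep_genWeightSpace ℂ H L)
  have heq := hind.eq_of_le_of_iSup_eq_top
    (U := fun ψ => ⨆ (w : (adaptedGrading e hb).Idx) (_ : χ w = ψ), (adaptedGrading e hb).space w)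
    (fun ψ => iSup₂_le fun w hw => hw ▸ hle w) (by
      rw [eq_top_iff, ← (adaptedGrading e hb).span]
      exact iSup_le fun w => le_iSup_of_le (χ w) (le_iSup₂_of_le w rfl le_rfl))
  have heq' (w : (adaptedGrading e hb).Idx) :
      (adaptedGrading e hb).space w = (LieAlgebra.rootSpace H (χ w)).toSubmodule := by
    rw [← heq]
    refine le_antisymm (le_iSup₂_of_le w rfl le_rfl) (iSup₂_le fun w' hw' => ?_)
    rw [hχ hw']
  ext W
  constructor
  · rintro ⟨w, rfl⟩
    exact ⟨(adaptedGrading e hb).ne_bot w, χ w, heq' w⟩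
  · rintro ⟨hW, ψ, rfl⟩
    by_cases hψ : ∃ w, χ w = ψ
    · obtain ⟨w, rfl⟩ := hψ
      exact ⟨w, heq' w⟩
    · refine absurd ?_ hW
      rw [← heq, iSup_eq_bot]
      intro w
      rw [iSup_eq_bot]
      exact fun hw => absurd ⟨w, hw⟩ hψ

end

end

/-! ### The exceptional isomorphism between $o(5)$ and $sp(4)$. -/

section

open Matrix Complex

attribute [local instance] LieRing.ofAssociativeRing

/-- The spin representation of `o(5)`, in terms of gamma matrices. -/
noncomputable def spinMat (X : Matrix (Fin 5) (Fin 5) ℂ) :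
    Matrix (Fin 2 ⊕ Fin 2) (Fin 2 ⊕ Fin 2) ℂ :=
  fromBlocks
    !![(I * X 0 1 - I * X 3 4) / 2, (-X 0 2 + I * X 1 2) / 2;
      (X 0 2 + I * X 1 2) / 2, (-I * X 0 1 - I * X 3 4) / 2]
    !![(-X 0 3 - I * X 0 4 + I * X 1 3 - X 1 4) / 2, (X 2 3 + I * X 2 4) / 2;
      (X 2 3 + I * X 2 4) / 2, (X 0 3 + I * X 0 4 + I * X 1 3 - X 1 4) / 2]
    !![(X 0 3 - I * X 0 4 + I * X 1 3 + X 1 4) / 2, (-X 2 3 + I * X 2 4) / 2;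
      (-X 2 3 + I * X 2 4) / 2, (-X 0 3 + I * X 0 4 + I * X 1 3 + X 1 4) / 2]
    !![(-I * X 0 1 + I * X 3 4) / 2, (-X 0 2 - I * X 1 2) / 2;
      (X 0 2 - I * X 1 2) / 2, (I * X 0 1 + I * X 3 4) / 2]

/-- A skew-symmetric matrix, in terms of its entries above the diagonal. -/
def skewOf (a b c d e f g h i j : ℂ) : Matrix (Fin 5) (Fin 5) ℂ :=
  !![0, a, b, c, d; -a, 0, e, f, g; -b, -e, 0, h, i; -c, -f, -h, 0, j; -d, -g, -i, -j, 0]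

theorem eq_skewOf {X : Matrix (Fin 5) (Fin 5) ℂ} (hX : Xᵀ = -X) :
    X = skewOf (X 0 1) (X 0 2) (X 0 3) (X 0 4) (X 1 2) (X 1 3) (X 1 4) (X 2 3) (X 2 4) (X 3 4) := by
  have h (i j) : X j i = -X i j := congrFun (congrFun hX i) j
  have h0 (i) : X i i = 0 := self_eq_neg.mp (h i i)
  ext i j
  fin_cases i <;> fin_cases j <;> first | exact h0 _ | rfl | exact h _ _

theorem skewOf_transpose (a b c d e f g h i j : ℂ) :
    (skewOf a b c d e f g h i j)ᵀ = -skewOf a b c d e f g h i j := by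
  ext k l
  fin_cases k <;> fin_cases l <;> simp [skewOf]

theorem mem_sp_iff {Y : Matrix (Fin 2 ⊕ Fin 2) (Fin 2 ⊕ Fin 2) ℂ} :
    Y ∈ LieAlgebra.Symplectic.sp (Fin 2) ℂ ↔ ∃ a b c : Matrix (Fin 2) (Fin 2) ℂ,
      bᵀ = b ∧ cᵀ = c ∧ Y = fromBlocks a b c (-aᵀ) := by
  rw [LieAlgebra.Symplectic.sp, mem_skewAdjointMatricesLieSubalgebra,
    mem_skewAdjointMatricesSubmodule]
  change Yᵀ * Matrix.J (Fin 2) ℂ = Matrix.J (Fin 2) ℂ * -Y ↔ _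
  rw [← fromBlocks_toBlocks Y]
  generalize Y.toBlocks₁₁ = a
  generalize Y.toBlocks₁₂ = b
  generalize Y.toBlocks₂₁ = c
  generalize Y.toBlocks₂₂ = d
  rw [Matrix.J, fromBlocks_transpose, fromBlocks_neg, fromBlocks_multiply, fromBlocks_multiply]
  simp only [fromBlocks_inj]
  constructor
  · rintro ⟨h1, h2, h3, h4⟩
    refine ⟨a, b, c, by simpa using h4, by simpa using h1, rfl, rfl, rfl, ?_⟩
    have : -aᵀ = d := by simpa using h2
    exact this.symm
  · rintro ⟨a', b', c', hb, hc, rfl, rfl, rfl, rfl⟩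
    simp [hb, hc]

theorem spinMat_mem (X : Matrix (Fin 5) (Fin 5) ℂ) :
    spinMat X ∈ LieAlgebra.Symplectic.sp (Fin 2) ℂ := by
  rw [mem_sp_iff]
  refine ⟨_, _, _, ?_, ?_, congrArg (fromBlocks _ _ _) ?_⟩
  · ext i j; fin_cases i <;> fin_cases j <;> rfl
  · ext i j; fin_cases i <;> fin_cases j <;> rfl
  · ext i j; fin_cases i <;> fin_cases j <;> simp <;> ring


set_option maxHeartbeats 1000000 in
theorem skewOf_lie (a b c d e f g h i j a' b' c' d' e' f' g' h' i' j' : ℂ) :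
    skewOf a b c d e f g h i j * skewOf a' b' c' d' e' f' g' h' i' j' -
      skewOf a' b' c' d' e' f' g' h' i' j' * skewOf a b c d e f g h i j =
      skewOf (-b * e' - c * f' - d * g' + e * b' + f * c' + g * d')
        (a * e' - c * h' - d * i' - e * a' + h * c' + i * d')
        (a * f' + b * h' - d * j' - f * a' - h * b' + j * d')
        (a * g' + b * i' + c * j' - g * a' - i * b' - j * c')
        (-a * b' + b * a' - f * h' + h * f' - g * i' + i * g')
        (-a * c' + c * a' + e * h' - h * e' - g * j' + j * g')
        (-a * d' + d * a' + e * i' - i * e' + f * j' - j * f')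
        (-b * c' + c * b' - e * f' + f * e' - i * j' + j * i')
        (-b * d' + d * b' - e * g' + g * e' + h * j' - j * h')
        (-c * d' + d * c' - f * g' + g * f' - h * i' + i * h') := by
  ext m n
  simp only [Matrix.sub_apply, Matrix.mul_apply, Fin.sum_univ_five]
  fin_cases m <;> fin_cases n <;> simp [skewOf] <;> ring

set_option maxHeartbeats 2000000 in
theorem spinMat_lie {X Y : Matrix (Fin 5) (Fin 5) ℂ} (hX : Xᵀ = -X) (hY : Yᵀ = -Y) :
    spinMat (X * Y - Y * X) = spinMat X * spinMat Y - spinMat Y * spinMat X := by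
  rw [eq_skewOf hX, eq_skewOf hY]
  generalize X 0 1 = a, X 0 2 = b, X 0 3 = c, X 0 4 = d, X 1 2 = e, X 1 3 = f, X 1 4 = g,
    X 2 3 = h, X 2 4 = i, X 3 4 = j, Y 0 1 = a', Y 0 2 = b', Y 0 3 = c', Y 0 4 = d', Y 1 2 = e',
    Y 1 3 = f', Y 1 4 = g', Y 2 3 = h', Y 2 4 = i', Y 3 4 = j'
  -- Once the commutator is again given by ten explicit entries, the claim is a polynomial identity
  -- in twenty parameters, with $I^2=-1$.
  rw [skewOf_lie]
  ext m n
  simp only [Matrix.sub_apply, Matrix.mul_apply, Fintype.sum_sum_type, Fin.sum_univ_two]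
  rcases m with m | m <;> rcases n with n | n <;> fin_cases m <;> fin_cases n <;>
    simp [spinMat, skewOf] <;> ring_nf <;> simp only [I_sq] <;> ring

/-- The inverse of the spin representation. -/
noncomputable def spinInv (Y : Matrix (Fin 2 ⊕ Fin 2) (Fin 2 ⊕ Fin 2) ℂ) :
    Matrix (Fin 5) (Fin 5) ℂ :=
  let a := Y.toBlocks₁₁
  let b := Y.toBlocks₁₂
  let c := Y.toBlocks₂₁
  skewOf (I * (a 1 1 - a 0 0)) (a 1 0 - a 0 1)
    ((b 1 1 - b 0 0 + c 0 0 - c 1 1) / 2) (I * (b 0 0 - b 1 1 + c 0 0 - c 1 1) / 2)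
    (-I * (a 0 1 + a 1 0)) (-I * (b 0 0 + b 1 1 + c 0 0 + c 1 1) / 2)
    ((-b 0 0 - b 1 1 + c 0 0 + c 1 1) / 2) (b 0 1 - c 0 1) (-I * (b 0 1 + c 0 1))
    (I * (a 0 0 + a 1 1))

set_option maxHeartbeats 1000000 in
theorem spinInv_spinMat {X : Matrix (Fin 5) (Fin 5) ℂ} (hX : Xᵀ = -X) :
    spinInv (spinMat X) = X := by
  conv_rhs => rw [eq_skewOf hX]
  simp only [spinInv, spinMat, toBlocks_fromBlocks₁₁, toBlocks_fromBlocks₁₂,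
    toBlocks_fromBlocks₂₁]
  congr 1 <;> simp <;> ring_nf <;> simp only [I_sq] <;> ring

set_option maxHeartbeats 1000000 in
theorem spinMat_spinInv {Y : Matrix (Fin 2 ⊕ Fin 2) (Fin 2 ⊕ Fin 2) ℂ}
    (hY : Y ∈ LieAlgebra.Symplectic.sp (Fin 2) ℂ) : spinMat (spinInv Y) = Y := by
  obtain ⟨a, b, c, hb, hc, rfl⟩ := mem_sp_iff.mp hY
  have hb' : b 1 0 = b 0 1 := congrFun (congrFun hb 0) 1
  have hc' : c 1 0 = c 0 1 := congrFun (congrFun hc 0) 1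
  rw [spinMat]
  congr 1 <;> ext m n <;> fin_cases m <;> fin_cases n <;>
    simp [spinInv, skewOf, hb', hc'] <;> ring_nf <;> simp only [I_sq] <;> ring

theorem spinMat_add (X Y : Matrix (Fin 5) (Fin 5) ℂ) :
    spinMat (X + Y) = spinMat X + spinMat Y := by
  simp only [spinMat, fromBlocks_add]
  congr 1 <;> ext m n <;> fin_cases m <;> fin_cases n <;> simp <;> ring

theorem spinMat_smul (r : ℂ) (X : Matrix (Fin 5) (Fin 5) ℂ) :
    spinMat (r • X) = r • spinMat X := by
  simp only [spinMat, fromBlocks_smul]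
  congr 1 <;> ext m n <;> fin_cases m <;> fin_cases n <;> simp <;> ring

/-- The exceptional isomorphism `o(5) ≃ sp(4)`. -/
noncomputable def spinEquiv : O5 ≃ₗ⁅ℂ⁆ Sp4 where
  toFun X := ⟨spinMat X, spinMat_mem X⟩
  map_add' X Y := Subtype.ext (spinMat_add X Y)
  map_smul' r X := Subtype.ext (spinMat_smul r X)
  map_lie' {X Y} := Subtype.ext <|
    spinMat_lie ((LieAlgebra.Orthogonal.mem_so _ _ _).mp X.2)
      ((LieAlgebra.Orthogonal.mem_so _ _ _).mp Y.2)
  invFun Y := ⟨spinInv Y, (LieAlgebra.Orthogonal.mem_so _ _ _).mpr (skewOf_transpose ..)⟩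
  left_inv X := Subtype.ext <| spinInv_spinMat ((LieAlgebra.Orthogonal.mem_so _ _ _).mp X.2)
  right_inv Y := Subtype.ext <| spinMat_spinInv Y.2

end

/-! ### Counting the subspaces, and the classification theorem. -/

section

variable {L : Type*} [LieRing L] [LieAlgebra ℂ L] (e : L ≃ₗ⁅ℂ⁆ O5) {k : Fin 3}
  {b : Fin 5 → Fin 5 → ℂ}

theorem card_idx_adaptedGrading (hb : IsAdaptedBasis k b) :
    Nat.card (adaptedGrading e hb).Idx = (Finset.univ.image (pairWeight k)).card := by
  change Nat.card {w // ∃ p, pairWeight k p = w} = _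
  rw [← Nat.card_eq_finsetCard]
  exact Nat.card_congr (Equiv.subtypeEquivRight fun w => by simp)

theorem numOfDim_adaptedGrading (hb : IsAdaptedBasis k b) (d : ℕ) :
    (adaptedGrading e hb).numOfDim d = ((Finset.univ.image (pairWeight k)).filter fun w =>
      (Finset.univ.filter fun p => pairWeight k p = w).card = d).card := by
  rw [← Nat.card_eq_finsetCard]
  refine Nat.card_congr ((Equiv.subtypeSubtypeEquivSubtypeInter
    (fun w => ∃ p, pairWeight k p = w)
    (fun w => Module.finrank ℂ (weightSpace e hb w) = d)).trans (Equiv.subtypeEquivRight fun w => ?_))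
  simp [finrank_weightSpace, Fintype.card_subtype]

end

theorem mainTheorem7 (L : Type*) [LieRing L] [LieAlgebra ℂ L]
    (hL : Nonempty (L ≃ₗ⁅ℂ⁆ O5) ∨ Nonempty (L ≃ₗ⁅ℂ⁆ Sp4)) :
    Nonempty (O5 ≃ₗ⁅ℂ⁆ Sp4) ∧
    ∃ (𝒢 : Fin 3 → Set (L ≃ₗ⁅ℂ⁆ L)) (Γ : Fin 3 → LieGrading L),
      -- exactly three MAD-groups up to conjugacy
      (∀ i, IsMADGroup (𝒢 i)) ∧
      (∀ i j, AreConjugate (𝒢 i) (𝒢 j) → i = j) ∧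
      (∀ G : Set (L ≃ₗ⁅ℂ⁆ L), IsMADGroup G → ∃ i, AreConjugate G (𝒢 i)) ∧
      -- exactly three fine group gradings up to equivalence
      (∀ i, (Γ i).IsFineGroupGrading) ∧
      (∀ i j, (Γ i).IsEquivalent (Γ j) → i = j) ∧
      (∀ Δ : LieGrading L, Δ.IsFineGroupGrading → ∃ i, Δ.IsEquivalent (Γ i)) ∧
      -- which correspond to the MAD-groups
      (∀ i, (Γ i).IsGeneratedBy (𝒢 i) ∧ (Γ i).Diag = 𝒢 i) ∧
      -- the first is the Cartan grading, of type `1 × 2`-dim `+ 8 × 1`-dim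
      ((Γ 0).IsCartanGrading ∧ Nat.card (Γ 0).Idx = 9 ∧
        (Γ 0).numOfDim 2 = 1 ∧ (Γ 0).numOfDim 1 = 8) ∧
      -- the other two are of type `10 × 1`-dim
      (Nat.card (Γ 1).Idx = 10 ∧ (Γ 1).numOfDim 1 = 10) ∧
      (Nat.card (Γ 2).Idx = 10 ∧ (Γ 2).numOfDim 1 = 10) := by
  refine ⟨⟨spinEquiv⟩, ?_⟩
  obtain ⟨e⟩ : Nonempty (L ≃ₗ⁅ℂ⁆ O5) :=
    hL.elim id fun ⟨f⟩ => ⟨f.trans spinEquiv.symm⟩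
  refine ⟨fun i => adaptedGroup e (stdAdapted i),
    fun i => adaptedGrading e (isAdaptedBasis_stdAdapted i),
    fun i => isMADGroup_adaptedGroup e (isAdaptedBasis_stdAdapted i),
    fun i j => eq_of_areConjugate_adaptedGroup e (isAdaptedBasis_stdAdapted i)
      (isAdaptedBasis_stdAdapted j),
    fun G hG => ?_,
    fun i => LieGrading.isFineGroupGrading_of_isMADGroup
      (isGroupGrading_adaptedGrading e _) (isMADGroup_adaptedGroup e (isAdaptedBasis_stdAdapted i))
      (adaptedGroup_subset_diag e _),
    fun i j h => ?_, fun Δ hΔ => ?_,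
    fun i => ⟨LieGrading.isGeneratedBy_of_isSeparatedBy _ (adaptedGroup_subset_diag e _)
      (isSeparatedBy_adaptedGroup e _), diag_adaptedGrading e _⟩,
    ⟨isCartanGrading_adaptedGrading e _, ?_, ?_, ?_⟩, ⟨?_, ?_⟩, ⟨?_, ?_⟩⟩
  · obtain ⟨k, b, hb, rfl⟩ := hG.exists_eq_adaptedGroup e
    exact ⟨k, areConjugate_adaptedGroup e hb (isAdaptedBasis_stdAdapted k)⟩
  -- Equivalent gradings have conjugate diagonal groups, so non-equivalence reduces to
  -- non-conjugacy.
  · have := h.areConjugate_diag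
    rw [diag_adaptedGrading, diag_adaptedGrading] at this
    exact eq_of_areConjugate_adaptedGroup e (isAdaptedBasis_stdAdapted i)
      (isAdaptedBasis_stdAdapted j) this
  · obtain ⟨k, b, hb, h⟩ := hΔ.exists_isSame e
    exact ⟨k, h.isEquivalent (isEquivalent_adaptedGrading e hb (isAdaptedBasis_stdAdapted k))⟩
  all_goals
    first | rw [card_idx_adaptedGrading] | rw [numOfDim_adaptedGrading]
    decide
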